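/- **Setting.** A *BGP instance* is a finite simple graph $G$ whose vertices (the ASes) are numbered $0,\dots,n-1$ (their AS numbers), in which some edges are directed from a customer to its provider and the other edges are undirected and join peers; there is no directed cycle. A path $(v_k\ \dots\ v_0)$ is *valley-free* if a step to a peer or to a customer is only followed by steps to customers. Its length is its number of edges. Paths are simple. Let $s,d,m$ be three distinct vertices (source, destination and manipulator). The vertex $d$ owns an IP prefix and announces the path $(d)$ to all its neighbours; the manipulator $m$ has *origin-spoofing* capabilities: it announces the path $(m)$, that is, itself as the origin of the prefix, to the vertices of a set $A$ of its neighbours, and announces nothing else. Every other vertex $v$ chooses among the paths $(v\ u)Q$ such that its neighbour $u$ announces $Q$ to $v$ and $v$ does not lie on $Q$. It prefers paths whose next hop $u$ is a customer over those whose next hop is a peer, and the latter over those whose next hop is a provider; then shorter paths; then paths whose next hop has the lower AS number; paths with the same next hop, class and length are compared as the next hop compares them. A vertex $v \neq m$ that has selected a path $Q$ announces it to exactly those neighbours $w$ for which $(w\ v)Q$ is valley-free. A *stable state* for $A$ is a choice of paths such that $d$ keeps $(d)$ and each vertex other than $d$ and $m$ has selected the path that it likes best among those which its neighbours announce to it (no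 path if there is none). The problem HIJACK (with origin-spoofing capabilities) asks, given $G,s,d,m$, whether there is a set $A$ of neighbours of $m$ with a stable state in which the path selected by $s$ ends in $m$. **Theorem.** If the length of the longest valley-free path is bounded by a constant, then HIJACK is in P. More precisely, there are an algorithm and a constant $c$ such that, for all $k \ge 1$ and all inputs $(G,s,d,m)$ with $n$ vertices in which every valley-free path has length at most $k$, the algorithm decides HIJACK in at most $n^{ck}$ steps; and for every constant $k$, HIJACK restricted to the inputs in which every valley-free path has length at most $k$ is in P. (Inputs are given by the $n\times n$ matrix of the relationships and the numbers $s,d,m$. Algorithms are while-programs over binary trees, one step being one elementary operation on a tree cell; this model is equivalent to Turing machines up to polynomial factors.) -/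

import Mathlib

/-! ## Binary trees and while-programs with a step count

The machine model: imperative programs whose variables hold binary trees.  One step inspects or
builds a single cell, as on a pointer machine, so a run of `t` steps creates at most `t` new cells
and can be simulated by a Turing machine in time polynomial in `t` and the size of the input.
Conversely such programs simulate Turing machines with constant overhead per step.  The only test
is the test whether a tree is `nil`. -/

namespace WhileProg

/-- Binary trees: the data of while-programs. -/
inductive Tree where
  | nil : Tree
  | cons : Tree → Tree → Tree
deriving DecidableEq

namespace Tree

/-- The number of nodes of a tree (leaves included). -/
def size : Tree → ℕ
  | nil => 1
  | cons a b => a.size + b.size + 1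

/-- Left subtree (`nil` for `nil`). -/
def hd : Tree → Tree
  | nil => nil
  | cons a _ => a

/-- Right subtree (`nil` for `nil`). -/
def tl : Tree → Tree
  | nil => nil
  | cons _ b => b

/-- Natural numbers in unary. -/
def ofNat : ℕ → Tree
  | 0 => nil
  | k + 1 => cons nil (ofNat k)

/-- Lists of trees as trees. -/
def ofList : List Tree → Tree
  | [] => nil
  | a :: l => cons a (ofList l)

end Tree

/-- Expressions over the variables `0, 1, 2, …`. -/
inductive Expr where
  | var : ℕ → Expr
  | nil : Expr
  | cons : Expr → Expr → Expr
  | hd : Expr → Expr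
  | tl : Expr → Expr

/-- Memory contents. -/
abbrev Store := ℕ → Tree

namespace Expr

def eval (σ : Store) : Expr → Tree
  | var x => σ x
  | nil => Tree.nil
  | cons a b => Tree.cons (a.eval σ) (b.eval σ)
  | hd a => (a.eval σ).hd
  | tl a => (a.eval σ).tl

/-- The number of operations that the evaluation of an expression takes. -/
def cost : Expr → ℕ
  | var _ => 1
  | nil => 1
  | cons a b => a.cost + b.cost + 1
  | hd a => a.cost + 1
  | tl a => a.cost + 1

end Expr

/-- Commands. -/
inductive Cmd where
  | skip : Cmd
  | assign : ℕ → Expr → Cmd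
  | seq : Cmd → Cmd → Cmd
  | ite : Expr → Cmd → Cmd → Cmd
  | loop : Expr → Cmd → Cmd

/-- `Exec c σ t σ'`: the command `c`, started in the store `σ`, halts after exactly `t` steps in
the store `σ'`.  In `ite e a b` and `loop e a` the condition `e` counts as true iff its value is
not `nil`. -/
inductive Exec : Cmd → Store → ℕ → Store → Prop where
  | skip (σ : Store) : Exec Cmd.skip σ 1 σ
  | assign (σ : Store) (x : ℕ) (e : Expr) :
      Exec (Cmd.assign x e) σ (e.cost + 1) (Function.update σ x (e.eval σ))
  | seq {a b : Cmd} {σ σ₁ σ₂ : Store} {t₁ t₂ : ℕ} :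
      Exec a σ t₁ σ₁ → Exec b σ₁ t₂ σ₂ → Exec (Cmd.seq a b) σ (t₁ + t₂) σ₂
  | iteTrue {e : Expr} {a b : Cmd} {σ σ₁ : Store} {t : ℕ} :
      e.eval σ ≠ Tree.nil → Exec a σ t σ₁ → Exec (Cmd.ite e a b) σ (e.cost + 1 + t) σ₁
  | iteFalse {e : Expr} {a b : Cmd} {σ σ₁ : Store} {t : ℕ} :
      e.eval σ = Tree.nil → Exec b σ t σ₁ → Exec (Cmd.ite e a b) σ (e.cost + 1 + t) σ₁
  | loopStep {e : Expr} {a : Cmd} {σ σ₁ σ₂ : Store} {t₁ t₂ : ℕ} :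
      e.eval σ ≠ Tree.nil → Exec a σ t₁ σ₁ → Exec (Cmd.loop e a) σ₁ t₂ σ₂ →
      Exec (Cmd.loop e a) σ (e.cost + 1 + t₁ + t₂) σ₂
  | loopDone {e : Expr} {a : Cmd} {σ : Store} :
      e.eval σ = Tree.nil → Exec (Cmd.loop e a) σ (e.cost + 1) σ

/-- Programs are deterministic: the final store and the number of steps are determined. -/
theorem Exec.det {c : Cmd} {σ : Store} {t : ℕ} {σ' : Store} (h : Exec c σ t σ') :
    ∀ {t₂ : ℕ} {σ₂ : Store}, Exec c σ t₂ σ₂ → t = t₂ ∧ σ' = σ₂ := by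
  induction h with
  | skip => intro _ _ h; cases h; exact ⟨rfl, rfl⟩
  | assign => intro _ _ h; cases h; exact ⟨rfl, rfl⟩
  | seq _ _ ih₁ ih₂ =>
    intro _ _ h
    cases h with
    | seq h₁ h₂ =>
      obtain ⟨rfl, rfl⟩ := ih₁ h₁
      obtain ⟨rfl, rfl⟩ := ih₂ h₂
      exact ⟨rfl, rfl⟩
  | iteTrue hc _ ih =>
    intro _ _ h
    cases h with
    | iteTrue _ h₁ => obtain ⟨rfl, rfl⟩ := ih h₁; exact ⟨rfl, rfl⟩
    | iteFalse hn _ => exact absurd hn hc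
  | iteFalse hc _ ih =>
    intro _ _ h
    cases h with
    | iteTrue hn _ => exact absurd hc hn
    | iteFalse _ h₁ => obtain ⟨rfl, rfl⟩ := ih h₁; exact ⟨rfl, rfl⟩
  | loopStep hc _ _ ih₁ ih₂ =>
    intro _ _ h
    cases h with
    | loopStep _ h₁ h₂ =>
      obtain ⟨rfl, rfl⟩ := ih₁ h₁
      obtain ⟨rfl, rfl⟩ := ih₂ h₂
      exact ⟨rfl, rfl⟩
    | loopDone hn => exact absurd hn hc
  | loopDone hc =>
    intro _ _ h
    cases h with
    | loopStep hn _ _ => exact absurd hc hn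
    | loopDone _ => exact ⟨rfl, rfl⟩

/-- The initial store: the input in variable `0`, all other variables `nil`. -/
def start (input : Tree) : Store := fun x => if x = 0 then input else Tree.nil

/-- On `input`, the program `p` halts after at most `bound` steps, and it accepts (ends with a
value other than `nil` in variable `0`) if and only if `Q` holds. -/
def DecidesWithin (p : Cmd) (input : Tree) (Q : Prop) (bound : ℕ) : Prop :=
  ∃ (t : ℕ) (σ : Store), Exec p (start input) t σ ∧ t ≤ bound ∧ (σ 0 ≠ Tree.nil ↔ Q)

/-- The class P: the decision problem `Q`, on inputs of type `α` given through the encoding `enc`,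
is decided by a program that halts in a number of steps polynomial in the size of the encoded
input. -/
def InP {α : Type} (enc : α → Tree) (Q : α → Prop) : Prop :=
  ∃ (p : Cmd) (f : Polynomial ℕ), ∀ a : α, DecidesWithin p (enc a) (Q a) (f.eval (enc a).size)

end WhileProg

/-! ## BGP routing -/

namespace BGP

/-- The possible relationships of a vertex `v` to a vertex `u`: not a neighbour, or a customer, a
peer, a provider of `u`. -/
inductive Link where
  | none : Link
  | customer : Link
  | peer : Link
  | provider : Link
deriving DecidableEq

namespace Link

/-- The same relationship seen from the other end. -/
def flip : Link → Link
  | none => none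
  | customer => provider
  | peer => peer
  | provider => customer

/-- The class of a path whose first edge leads to a customer (`3`), peer (`2`), provider (`1`). -/
def cls : Link → ℕ
  | none => 0
  | customer => 3
  | peer => 2
  | provider => 1

/-- Code of a relationship as a tree. -/
def toTree : Link → WhileProg.Tree
  | none => WhileProg.Tree.ofNat 0
  | customer => WhileProg.Tree.ofNat 1
  | peer => WhileProg.Tree.ofNat 2
  | provider => WhileProg.Tree.ofNat 3

end Link

/-- A BGP instance on the vertices (ASes) `0, …, n - 1`: a partially directed simple graph without
directed (customer-provider) cycles.  `link u v` tells what `v` is for `u`; the edge between `u`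
and `v` is directed from `u` to `v` iff `link u v = provider`, undirected iff `link u v = peer`.
The AS number of a vertex is its position in `Fin n`. -/
structure Network (n : ℕ) where
  link : Fin n → Fin n → Link
  link_self : ∀ u, link u u = Link.none
  link_flip : ∀ u v, link v u = (link u v).flip
  acyclic : ∀ u, ¬ Relation.TransGen (fun a b => link a b = Link.provider) u u

namespace Network

variable {n : ℕ}

/-- A list `v_k, …, v_0` of vertices is a valley-free walk: consecutive vertices are adjacent, and
a step to a peer or to a customer is only followed by steps to customers. -/
def ValleyFree (G : Network n) : List (Fin n) → Prop
  | [] => True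
  | [_] => True
  | [u, v] => G.link u v ≠ Link.none
  | u :: v :: w :: P =>
      G.link u v ≠ Link.none ∧ (G.link u v ≠ Link.provider → G.link v w = Link.customer) ∧
        ValleyFree G (v :: w :: P)

/-- Every valley-free (simple) path of `G` has length at most `k`; the length of a path is its
number of edges. -/
def PathsBounded (G : Network n) (k : ℕ) : Prop :=
  ∀ P : List (Fin n), P.Nodup → G.ValleyFree P → P.length ≤ k + 1

/-- `G.Prefers P Q`: for paths `P`, `Q` from the same vertex, the first one is strictly preferred:
it is of better class; or of the same class and shorter; or of the same class and length and its
next hop has a lower AS number; or all this is the same and the next hop prefers the rest of `P` to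
the rest of `Q`. -/
def Prefers (G : Network n) : List (Fin n) → List (Fin n) → Prop
  | v :: u :: P, v' :: u' :: Q =>
      (G.link v' u').cls < (G.link v u).cls ∨
        ((G.link v u).cls = (G.link v' u').cls ∧
          (P.length < Q.length ∨
            (P.length = Q.length ∧ (u < u' ∨ (u = u' ∧ Prefers G (u :: P) (u' :: Q))))))
  | _, _ => False

/-- A routing state: the path selected by each vertex, if any.  A path of `v` is listed from `v` to
the (real or pretended) origin of the prefix, both included. -/
abbrev State (n : ℕ) := Fin n → Option (List (Fin n))

/-- In the state `S`, while `m` pretends towards the vertices in `A` (and towards no one else) to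
be the origin of the prefix, the vertex `u` announces the path `Q` to its neighbour `v`.  Vertices
other than `m` announce the path that they have selected to every neighbour to which this does not
create a path with a valley. -/
def Announces (G : Network n) (m : Fin n) (A : Finset (Fin n)) (S : State n)
    (u v : Fin n) (Q : List (Fin n)) : Prop :=
  G.link v u ≠ Link.none ∧
    ((u = m ∧ v ∈ A ∧ Q = [m]) ∨ (u ≠ m ∧ S u = some Q ∧ G.ValleyFree (v :: Q)))

/-- `P` is one of the paths among which `v` can choose: `v` followed by a path that a neighbour
announces to `v` and that does not contain `v` (loop detection). -/
def Candidate (G : Network n) (m : Fin n) (A : Finset (Fin n)) (S : State n)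
    (v : Fin n) (P : List (Fin n)) : Prop :=
  ∃ (u : Fin n) (Q : List (Fin n)), G.Announces m A S u v Q ∧ v ∉ Q ∧ P = v :: Q

/-- `S` is a stable routing state when `d` owns the prefix and `m` announces itself as its origin
exactly to the vertices in `A`: the origin `d` keeps its trivial path, and every other vertex, with
the exception of `m`, selects its most preferred candidate (no path if there is none). -/
def Stable (G : Network n) (d m : Fin n) (A : Finset (Fin n)) (S : State n) : Prop :=
  S d = some [d] ∧
    ∀ v, v ≠ d → v ≠ m →
      (S v = none ∧ ∀ P, ¬ G.Candidate m A S v P) ∨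
        ∃ P, S v = some P ∧ G.Candidate m A S v P ∧
          ∀ Q, G.Candidate m A S v Q → Q ≠ P → G.Prefers P Q

end Network

/-- An input of the hijack problem for a manipulator with origin-spoofing capabilities: a network,
a source `s`, a destination `d` (the owner of the prefix) and a manipulator `m`. -/
structure HijackInput where
  n : ℕ
  G : Network n
  s : Fin n
  d : Fin n
  m : Fin n
  s_ne_d : s ≠ d
  s_ne_m : s ≠ m
  d_ne_m : d ≠ m

namespace HijackInput

/-- The question of the hijack problem: is there a set `A` of neighbours of `m` such that, when `m`
announces itself to the vertices in `A` as the origin of the prefix, there is a stable state in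
which the traffic from `s` to `d` goes to `m`, that is, the path of `s` ends in `m`? -/
def Hijack (I : HijackInput) : Prop :=
  ∃ A : Finset (Fin I.n), (∀ v ∈ A, I.G.link I.m v ≠ Link.none) ∧
    ∃ S : Network.State I.n, I.G.Stable I.d I.m A S ∧
      ∃ P : List (Fin I.n), S I.s = some P ∧ P.getLast? = some I.m

/-- The input as a tree: the list of the rows of the matrix of relationships, then `s`, `d`, `m` in
unary. -/
def toTree (I : HijackInput) : WhileProg.Tree :=
  WhileProg.Tree.ofList
    [WhileProg.Tree.ofList ((List.finRange I.n).map fun u =>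
        WhileProg.Tree.ofList ((List.finRange I.n).map fun v => (I.G.link u v).toTree)),
      WhileProg.Tree.ofNat I.s, WhileProg.Tree.ofNat I.d, WhileProg.Tree.ofNat I.m]

end HijackInput

end BGP

/-! The proof rests on two ideas. First, a stable state is determined by `A`, apart from its
irrelevant entry at `m`. Classes dominate preferences, and whether a valley-free path can be
extended depends only on its class or on its being trivial. So in a stable state every selected
route is `Greedy`: each suffix has the best class available from its first vertex. Greedy routes
from a common vertex share their class, so prepending a vertex respects preference among them
(`Prefers.cons`), and every vertex gets its most preferred greedy route (`Best`). `stable_bestState`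
shows that these choices are stable, `Stable.best` that nothing else is. HIJACK thus asks for a set
`A` whose best route from `s` ends in `m` (`hijack_iff`).

Second, the search over the exponentially many sets `A` becomes a search over target paths `p`. A
route `p` is best iff no greedy route improves on a suffix of `p` by class, length or next hop
(`Best.not_beats`, `best_of_not_beats`). Enlarging `A` only adds competitors, so a route that is
greedy for a larger set stays greedy for a smaller one as long as it is still a route
(`Greedy.anti`). Start with all neighbours of `m` and repeatedly delete those through which some
greedy route beats `p`: no element of a set that makes `p` best is ever deleted
(`Best.subset_prune`). After `n` rounds the remaining set is the largest one that makes `p` best, if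
there is any (`hijack_iff_target`).

The bound `k` enters only through the number of routes, at most `n ^ (k + 1)`. All tests are loops
over the vertices, the list of routes and the suffixes of a route, written with combinators for
`Computes`. Time is measured in `n ^ k`, but `k` is not part of the input, so a single program
serves all `k`. -/

namespace BGP
namespace Network

/-! ### Routes and greedy routes -/

variable {n : ℕ} (G : Network n) (d m : Fin n)

/-- The class of a path: the class of its first edge. -/
def pcls : List (Fin n) → ℕ
  | v :: u :: _ => (G.link v u).cls
  | _ => 0

/-- Simple valley-free paths to the origin `d`, or to the pretended origin `m` through a vertex
of `A`, that do not pass through `d` or `m` before their end. -/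
inductive Route (A : Set (Fin n)) : List (Fin n) → Prop
  | dest : Route A [d]
  | fake : Route A [m]
  | cons {v : Fin n} {P : List (Fin n)} : Route A P → v ∉ P → v ≠ d → v ≠ m →
      G.ValleyFree (v :: P) → (P = [m] → v ∈ A) → Route A (v :: P)

variable {G d m}

/-- In this form the condition at the first step sees the rest of the path only through its class
and triviality, which is what makes tails exchangeable. -/
theorem valleyFree_cons_cons {v u : Fin n} {P : List (Fin n)} :
    G.ValleyFree (v :: u :: P) ↔ G.link v u ≠ Link.none ∧
      (G.link v u ≠ Link.provider → P = [] ∨ G.pcls (u :: P) = 3) ∧ G.ValleyFree (u :: P) := by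
  cases P with
  | nil => simp [ValleyFree]
  | cons w P =>
    have : (G.link u w).cls = 3 ↔ G.link u w = Link.customer := by
      cases G.link u w <;> simp [Link.cls]
    simp [ValleyFree, pcls, this]

theorem Route.ne_nil {A : Set (Fin n)} {P : List (Fin n)} (h : G.Route d m A P) : P ≠ [] := by
  cases h <;> simp

theorem Route.nodup {A : Set (Fin n)} {P : List (Fin n)} (h : G.Route d m A P) : P.Nodup := by
  induction h with
  | dest => simp
  | fake => simp
  | cons _ hv _ _ _ _ ih => exact List.nodup_cons.2 ⟨hv, ih⟩

theorem Route.valleyFree {A : Set (Fin n)} {P : List (Fin n)} (h : G.Route d m A P) :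
    G.ValleyFree P := by
  cases h with
  | dest => simp [ValleyFree]
  | fake => simp [ValleyFree]
  | cons _ _ _ _ h _ => exact h

theorem Route.suffix {A : Set (Fin n)} {P : List (Fin n)} (h : G.Route d m A P) :
    ∀ {T : List (Fin n)}, T <:+ P → T ≠ [] → G.Route d m A T := by
  induction h with
  | dest =>
    intro T hT h0
    rcases List.suffix_cons_iff.1 hT with rfl | h
    · exact .dest
    · exact absurd (List.suffix_nil.1 h) h0
  | fake =>
    intro T hT h0
    rcases List.suffix_cons_iff.1 hT with rfl | h
    · exact .fake
    · exact absurd (List.suffix_nil.1 h) h0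
  | cons hP hv hd hm hvf hA ih =>
    intro T hT h0
    rcases List.suffix_cons_iff.1 hT with rfl | h
    · exact .cons hP hv hd hm hvf hA
    · exact ih h h0

theorem Route.mono {A B : Set (Fin n)} (hAB : A ⊆ B) {P : List (Fin n)}
    (h : G.Route d m A P) : G.Route d m B P := by
  induction h with
  | dest => exact .dest
  | fake => exact .fake
  | cons _ hv hd hm hvf hA ih => exact .cons ih hv hd hm hvf fun h => hAB (hA h)

theorem Route.eq_singleton {A : Set (Fin n)} {P : List (Fin n)} (h : G.Route d m A P)
    {v : Fin n} (hv : P.head? = some v) (h0 : v = d ∨ v = m) : P = [v] := by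
  cases h with
  | dest => simp_all
  | fake => simp_all
  | cons _ _ hd hm _ _ =>
    simp only [List.head?_cons, Option.some.injEq] at hv
    subst hv
    exact absurd h0 (by simp [hd, hm])

theorem Route.exists_cons_cons {A : Set (Fin n)} {P : List (Fin n)} (h : G.Route d m A P)
    {v : Fin n} (hv : P.head? = some v) (hd : v ≠ d) (hm : v ≠ m) :
    ∃ u T, P = v :: u :: T := by
  cases h with
  | dest => simp_all
  | fake => simp_all
  | cons hP _ _ _ _ _ =>
    simp only [List.head?_cons, Option.some.injEq] at hv
    subst hv
    obtain ⟨u, T, rfl⟩ := List.exists_cons_of_ne_nil hP.ne_nil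
    exact ⟨u, T, rfl⟩

theorem Route.origin_of_singleton {A : Set (Fin n)} {v : Fin n} (h : G.Route d m A [v]) :
    v = d ∨ v = m := by
  cases h with
  | dest => simp
  | fake => simp
  | cons h => exact absurd rfl h.ne_nil

theorem pcls_le (P : List (Fin n)) : G.pcls P ≤ 3 := by
  rcases P with _ | ⟨v, _ | ⟨u, P⟩⟩
  · simp [pcls]
  · simp [pcls]
  · simp only [pcls]; cases G.link v u <;> simp [Link.cls]

theorem Route.pcls_pos {A : Set (Fin n)} {P : List (Fin n)} (h : G.Route d m A P)
    {v : Fin n} (hv : P.head? = some v) (hd : v ≠ d) (hm : v ≠ m) : 1 ≤ G.pcls P := by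
  obtain ⟨u, T, rfl⟩ := h.exists_cons_cons hv hd hm
  have := (valleyFree_cons_cons.1 h.valleyFree).1
  simp only [pcls]
  revert this
  cases G.link v u <;> simp [Link.cls]

/-- Replacing the rest of a route by another route from the next hop that is a single vertex or of
at least the same class. -/
theorem Route.valleyFree_replace {A : Set (Fin n)} {v : Fin n} {P Q : List (Fin n)}
    (h : G.Route d m A (v :: P)) (hP : G.Route d m A P) (hQ : G.Route d m A Q)
    (hd : Q.head? = P.head?)
    (hc : G.pcls P ≤ G.pcls Q) : G.ValleyFree (v :: Q) := by
  obtain ⟨u, P, rfl⟩ := List.exists_cons_of_ne_nil hP.ne_nil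
  obtain ⟨u', Q, rfl⟩ := List.exists_cons_of_ne_nil hQ.ne_nil
  simp only [List.head?_cons, Option.some.injEq] at hd
  subst hd
  obtain ⟨h1, h2, -⟩ := valleyFree_cons_cons.1 h.valleyFree
  refine valleyFree_cons_cons.2 ⟨h1, fun h3 => ?_, hQ.valleyFree⟩
  rcases h2 h3 with rfl | h4
  · left
    have := hQ.eq_singleton (v := u') rfl hP.origin_of_singleton
    simpa using this
  · exact Or.inr (le_antisymm (pcls_le _) (h4 ▸ hc))

theorem Route.tail {A : Set (Fin n)} {v u : Fin n} {P : List (Fin n)}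
    (h : G.Route d m A (v :: u :: P)) : G.Route d m A (u :: P) :=
  h.suffix (List.suffix_cons _ _) (by simp)

/-- After a step to a provider any valley-free tail is allowed; after other steps a tail of at least
the old class will do. A new tail `[m]` forces `u = m`, so the old tail was `[m]` too and `v ∈ A` is
already known. -/
theorem Route.replace {A : Set (Fin n)} {v u : Fin n} {P Q : List (Fin n)}
    (h : G.Route d m A (v :: u :: P)) (hQ : G.Route d m A Q)
    (hd : Q.head? = some u) (hc : G.link v u ≠ Link.provider → G.pcls (u :: P) ≤ G.pcls Q)
    (hv : v ∉ Q) : G.Route d m A (v :: Q) := by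
  have hvf : G.ValleyFree (v :: Q) := by
    by_cases hp : G.link v u = Link.provider
    · obtain ⟨u', Q, rfl⟩ := List.exists_cons_of_ne_nil hQ.ne_nil
      simp only [List.head?_cons, Option.some.injEq] at hd
      subst hd
      exact valleyFree_cons_cons.2 ⟨by simp [hp], by simp [hp], hQ.valleyFree⟩
    · exact h.valleyFree_replace h.tail hQ (by simpa using hd) (hc hp)
  have ht := h.tail
  cases h with
  | cons _ _ h1 h2 _ h3 =>
    refine .cons hQ hv h1 h2 hvf fun hQm => h3 ?_
    subst hQm
    simp only [List.head?_cons, Option.some.injEq] at hd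
    subst hd
    exact ht.eq_singleton (v := m) rfl (Or.inr rfl)

theorem exists_suffix_of_mem {v : Fin n} {Q : List (Fin n)} (h : v ∈ Q) :
    ∃ T, (v :: T) <:+ Q := by
  obtain ⟨s, t, rfl⟩ := List.append_of_mem h
  exact ⟨t, s, rfl⟩

variable (G d m) in
/-- Routes each of whose suffixes is of the best class available to its first vertex. -/
def Greedy (A : Set (Fin n)) (P : List (Fin n)) : Prop :=
  G.Route d m A P ∧ ∀ T, T <:+ P → T ≠ [] → ∀ R, G.Route d m A R → R.head? = T.head? →
    G.pcls R ≤ G.pcls T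

theorem Greedy.suffix {A : Set (Fin n)} {P T : List (Fin n)} (h : G.Greedy d m A P)
    (hT : T <:+ P) (h0 : T ≠ []) : G.Greedy d m A T :=
  ⟨h.1.suffix hT h0, fun U hU => h.2 U (hU.trans hT)⟩

/-- A smaller set offers fewer competing routes. The pruning argument depends on this monotonicity.
-/
theorem Greedy.anti {A B : Set (Fin n)} (hAB : A ⊆ B) {P : List (Fin n)}
    (h : G.Greedy d m B P) (hP : G.Route d m A P) : G.Greedy d m A P :=
  ⟨hP, fun T hT h0 R hR => h.2 T hT h0 R (hR.mono hAB)⟩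

theorem Greedy.pcls_eq {A : Set (Fin n)} {P Q : List (Fin n)} (hP : G.Greedy d m A P)
    (hQ : G.Greedy d m A Q) (h : P.head? = Q.head?) : G.pcls P = G.pcls Q :=
  le_antisymm (hQ.2 Q List.suffix_rfl hQ.1.ne_nil P hP.1 h)
    (hP.2 P List.suffix_rfl hP.1.ne_nil Q hQ.1 h.symm)

theorem Greedy.cons {A : Set (Fin n)} {v : Fin n} {P : List (Fin n)} (hP : G.Greedy d m A P)
    (h : G.Route d m A (v :: P))
    (hc : ∀ R, G.Route d m A R → R.head? = some v → G.pcls R ≤ G.pcls (v :: P)) :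
    G.Greedy d m A (v :: P) := by
  refine ⟨h, fun T hT h0 R hR hd => ?_⟩
  rcases List.suffix_cons_iff.1 hT with rfl | h
  · exact hc R hR hd
  · exact hP.2 T h h0 R hR hd

theorem Greedy.singleton {A : Set (Fin n)} {v : Fin n} (h : G.Route d m A [v]) :
    G.Greedy d m A [v] := by
  refine ⟨h, fun T hT h0 R hR hd => ?_⟩
  rcases List.suffix_cons_iff.1 hT with rfl | hT
  · rw [hR.eq_singleton hd h.origin_of_singleton]
  · exact absurd (List.suffix_nil.1 hT) h0

/-- A route that starts with a step to a customer only has such steps, so all its nontrivial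
suffixes attain the maximal class `3`. -/
theorem Route.greedy_of_cls {A : Set (Fin n)} {P : List (Fin n)} (h : G.Route d m A P)
    (hc : G.pcls P = 3) : G.Greedy d m A P := by
  induction h with
  | dest => exact .singleton .dest
  | fake => exact .singleton .fake
  | @cons v P hP hv hd hm hvf hA ih =>
    refine Greedy.cons ?_ (.cons hP hv hd hm hvf hA) (fun R _ _ => hc ▸ pcls_le R)
    obtain ⟨u, P, rfl⟩ := List.exists_cons_of_ne_nil hP.ne_nil
    obtain ⟨h1, h2, -⟩ := valleyFree_cons_cons.1 hvf
    simp only [pcls] at hc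
    rcases h2 (by rintro h; simp [h, Link.cls] at hc) with rfl | h3
    · exact .singleton hP
    · exact ih h3

/-- In a route of class `3` all suffixes that are not single vertices have class `3`. -/
theorem Route.pcls_suffix {A : Set (Fin n)} {P : List (Fin n)} (h : G.Route d m A P)
    (hc : G.pcls P = 3) {v : Fin n} {T : List (Fin n)} (hT : (v :: T) <:+ P) (h0 : T ≠ []) :
    G.pcls (v :: T) = 3 := by
  induction h with
  | dest => simp [pcls] at hc
  | fake => simp [pcls] at hc
  | @cons w P hP hv hd hm hvf hA ih =>
    rcases List.suffix_cons_iff.1 hT with h | h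
    · rw [h]; exact hc
    · obtain ⟨u, P, rfl⟩ := List.exists_cons_of_ne_nil hP.ne_nil
      obtain ⟨h1, h2, -⟩ := valleyFree_cons_cons.1 hvf
      simp only [pcls] at hc
      rcases h2 (by rintro h; simp [h, Link.cls] at hc) with rfl | h3
      · rcases List.suffix_cons_iff.1 h with h | h
        · simp at h; exact absurd h.2 h0
        · simp at h
      · exact ih h3 h

/-- A route of class `3` is greedy. If `2` is the best class at `v`, a route of that class is a peer
step followed by a trivial or class `3` route, hence greedy. If only class `1` is available, the
first step leads to a provider, and `v` can be put before any greedy route from there; should that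
route already contain `v`, its suffix from `v` is greedy. -/
theorem Route.exists_greedy {A : Set (Fin n)} {P : List (Fin n)} (h : G.Route d m A P) :
    ∃ Q, G.Greedy d m A Q ∧ Q.head? = P.head? := by
  induction h with
  | dest => exact ⟨_, .singleton .dest, rfl⟩
  | fake => exact ⟨_, .singleton .fake, rfl⟩
  | @cons v P hP hv hd hm hvf hA ih =>
    have hR0 : G.Route d m A (v :: P) := .cons hP hv hd hm hvf hA
    by_cases h3 : ∃ R, G.Route d m A R ∧ R.head? = some v ∧ G.pcls R = 3
    · obtain ⟨R, hR, hRv, hc⟩ := h3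
      exact ⟨R, hR.greedy_of_cls hc, by simpa using hRv⟩
    have h3' : ∀ R, G.Route d m A R → R.head? = some v → G.pcls R ≤ 2 := by
      intro R hR hRv
      by_contra hlt
      exact h3 ⟨R, hR, hRv, le_antisymm (pcls_le R) (by omega)⟩
    by_cases h2 : ∃ R, G.Route d m A R ∧ R.head? = some v ∧ G.pcls R = 2
    · obtain ⟨R, hR, hRv, hc⟩ := h2
      refine ⟨R, ?_, by simpa using hRv⟩
      obtain ⟨u, T, rfl⟩ := hR.exists_cons_cons hRv hd hm
      refine Greedy.cons ?_ hR (fun R' hR' hv' => hc ▸ h3' R' hR' hv')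
      obtain ⟨-, h2, -⟩ := valleyFree_cons_cons.1 hR.valleyFree
      simp only [pcls] at hc
      rcases h2 (by rintro h; simp [h, Link.cls] at hc) with rfl | h3
      · exact .singleton hR.tail
      · exact hR.tail.greedy_of_cls h3
    have h2' : ∀ R, G.Route d m A R → R.head? = some v → G.pcls R ≤ 1 := by
      intro R hR hRv
      by_contra hlt
      exact h2 ⟨R, hR, hRv, le_antisymm (h3' R hR hRv) (by omega)⟩
    obtain ⟨Q, hQ, hQd⟩ := ih
    by_cases hvQ : v ∈ Q
    · obtain ⟨T, hT⟩ := exists_suffix_of_mem hvQ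
      exact ⟨v :: T, hQ.suffix hT (by simp), rfl⟩
    · obtain ⟨u, P, rfl⟩ := List.exists_cons_of_ne_nil hP.ne_nil
      have h1 := h2' _ hR0 rfl
      have hp : G.link v u = Link.provider := by
        have h1' := hR0.pcls_pos rfl hd hm
        simp only [pcls] at h1 h1'
        revert h1 h1'
        cases G.link v u <;> simp [Link.cls]
      have hvQ' := hR0.replace hQ.1 (by simpa using hQd) (by simp [hp]) hvQ
      exact ⟨v :: Q, hQ.cons hvQ' fun R hR hRv =>
        (h2' R hR hRv).trans (hvQ'.pcls_pos rfl hd hm), rfl⟩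

/-! ### The order of preference -/

theorem prefers_cons_cons {v u v' u' : Fin n} {P Q : List (Fin n)} :
    G.Prefers (v :: u :: P) (v' :: u' :: Q) ↔
      (G.link v' u').cls < (G.link v u).cls ∨
        ((G.link v u).cls = (G.link v' u').cls ∧
          (P.length < Q.length ∨
            (P.length = Q.length ∧
              (u < u' ∨ (u = u' ∧ G.Prefers (u :: P) (u' :: Q)))))) := by
  rw [Prefers]

theorem Prefers.exists_cons {P Q : List (Fin n)} (h : G.Prefers P Q) :
    ∃ v u P' v' u' Q', P = v :: u :: P' ∧ Q = v' :: u' :: Q' := by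
  rcases P with _ | ⟨v, _ | ⟨u, P⟩⟩
  · simp [Prefers] at h
  · simp [Prefers] at h
  · rcases Q with _ | ⟨v', _ | ⟨u', Q⟩⟩
    · simp [Prefers] at h
    · simp [Prefers] at h
    · exact ⟨_, _, _, _, _, _, rfl, rfl⟩

theorem prefers_irrefl (P : List (Fin n)) : ¬ G.Prefers P P := by
  induction P with
  | nil => simp [Prefers]
  | cons v P ih =>
    cases P with
    | nil => simp [Prefers]
    | cons u P => rw [prefers_cons_cons]; simpa using ih

theorem Prefers.trans {P : List (Fin n)} :
    ∀ {Q R : List (Fin n)}, G.Prefers P Q → G.Prefers Q R → G.Prefers P R := by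
  induction P with
  | nil => intro Q R h; simp [Prefers] at h
  | cons v P ih =>
    intro Q R h1 h2
    obtain ⟨v1, u1, P1, v2, u2, P2, h, rfl⟩ := h1.exists_cons
    obtain ⟨_, _, _, v3, u3, P3, -, rfl⟩ := h2.exists_cons
    simp only [List.cons.injEq] at h
    obtain ⟨rfl, rfl⟩ := h
    rw [prefers_cons_cons] at h1 h2 ⊢
    have key : u1 = u2 → u2 = u3 → G.Prefers (u1 :: P1) (u2 :: P2) →
        G.Prefers (u2 :: P2) (u3 :: P3) → G.Prefers (u1 :: P1) (u3 :: P3) :=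
      fun _ _ h h' => ih h h'
    -- Each preference is decided by class, length, next hop or recursively. Arithmetic settles
    -- every combination except the one where both are recursive.
    rcases h1 with h1 | ⟨e1, h1 | ⟨l1, h1 | ⟨n1, h1⟩⟩⟩ <;>
    rcases h2 with h2 | ⟨e2, h2 | ⟨l2, h2 | ⟨n2, h2⟩⟩⟩ <;>
    first | (left; omega) | (right; refine ⟨by omega, ?_⟩)
    all_goals first | (left; omega) | (right; refine ⟨by omega, ?_⟩)
    all_goals first | (left; omega) | (right; refine ⟨by omega, key n1 n2 h1 h2⟩)

theorem Prefers.asymm {P Q : List (Fin n)} (h : G.Prefers P Q) : ¬ G.Prefers Q P :=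
  fun h' => prefers_irrefl P (h.trans h')

theorem prefers_total {v : Fin n} {P Q : List (Fin n)} (hP : P ≠ []) (hQ : Q ≠ [])
    (hne : P ≠ Q) : G.Prefers (v :: P) (v :: Q) ∨ G.Prefers (v :: Q) (v :: P) := by
  induction P generalizing v Q with
  | nil => exact absurd rfl hP
  | cons u P ih =>
    obtain ⟨u', Q, rfl⟩ := List.exists_cons_of_ne_nil hQ
    rw [prefers_cons_cons, prefers_cons_cons]
    rcases lt_trichotomy (G.link v u).cls (G.link v u').cls with h | h | h
    · exact Or.inr (Or.inl h)
    · rcases lt_trichotomy P.length Q.length with hl | hl | hl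
      · exact Or.inl (Or.inr ⟨h, Or.inl hl⟩)
      · rcases lt_trichotomy u u' with hu | hu | hu
        · exact Or.inl (Or.inr ⟨h, Or.inr ⟨hl, Or.inl hu⟩⟩)
        · subst hu
          have hne' : P ≠ Q := by simpa using hne
          have hP' : P ≠ [] := by
            rintro rfl
            exact hne' (List.length_eq_zero_iff.1 hl.symm).symm
          have hQ' : Q ≠ [] := by
            rintro rfl
            exact hne' (List.length_eq_zero_iff.1 hl)
          rcases ih (v := u) hP' hQ' hne' with h1 | h1
          · exact Or.inl (Or.inr ⟨h, Or.inr ⟨hl, Or.inr ⟨rfl, h1⟩⟩⟩)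
          · exact Or.inr (Or.inr ⟨h.symm, Or.inr ⟨hl.symm, Or.inr ⟨rfl, h1⟩⟩⟩)
        · exact Or.inr (Or.inr ⟨h.symm, Or.inr ⟨hl.symm, Or.inl hu⟩⟩)
      · exact Or.inr (Or.inr ⟨h.symm, Or.inl hl⟩)
    · exact Or.inl (Or.inl h)

theorem Prefers.length_le {P Q : List (Fin n)} (h : G.Prefers P Q) (hc : G.pcls P = G.pcls Q) :
    P.length ≤ Q.length := by
  obtain ⟨v, u, P, v', u', Q, rfl, rfl⟩ := h.exists_cons
  simp only [pcls] at hc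
  rw [prefers_cons_cons] at h
  simp only [List.length_cons]
  omega

theorem Prefers.pcls_le {P Q : List (Fin n)} (h : G.Prefers P Q) : G.pcls Q ≤ G.pcls P := by
  obtain ⟨v, u, P, v', u', Q, rfl, rfl⟩ := h.exists_cons
  rw [prefers_cons_cons] at h
  simp only [pcls]
  omega

theorem prefers_of_pcls {v u v' u' : Fin n} {P Q : List (Fin n)}
    (h : G.pcls (v' :: u' :: Q) < G.pcls (v :: u :: P)) :
    G.Prefers (v :: u :: P) (v' :: u' :: Q) :=
  prefers_cons_cons.2 (Or.inl h)

theorem prefers_of_length {v u v' u' : Fin n} {P Q : List (Fin n)}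
    (hc : G.pcls (v :: u :: P) = G.pcls (v' :: u' :: Q)) (h : P.length < Q.length) :
    G.Prefers (v :: u :: P) (v' :: u' :: Q) :=
  prefers_cons_cons.2 (Or.inr ⟨hc, Or.inl h⟩)

/-- Equality of the classes is essential: a tail preferred for its class may be longer, and `v`
compares lengths before it asks the next hop. -/
theorem Prefers.cons {v : Fin n} {P Q : List (Fin n)} (h : G.Prefers P Q)
    (hc : G.pcls P = G.pcls Q) (hd : P.head? = Q.head?) : G.Prefers (v :: P) (v :: Q) := by
  have hl := h.length_le hc
  obtain ⟨u, w, P, u', w', Q, rfl, rfl⟩ := h.exists_cons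
  simp only [List.head?_cons, Option.some.injEq] at hd
  subst hd
  rw [prefers_cons_cons]
  refine Or.inr ⟨rfl, ?_⟩
  rcases lt_or_eq_of_le hl with hl | hl
  · left; simpa using hl
  · right; exact ⟨by simpa using hl, Or.inr ⟨rfl, h⟩⟩

/-! ### Most preferred greedy routes -/

variable (G d m) in
/-- `P` is the most preferred greedy route from `v`. -/
def Best (A : Set (Fin n)) (v : Fin n) (P : List (Fin n)) : Prop :=
  G.Greedy d m A P ∧ P.head? = some v ∧
    ∀ Q, G.Greedy d m A Q → Q.head? = some v → Q ≠ P → G.Prefers P Q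

theorem Best.unique {A : Set (Fin n)} {v : Fin n} {P Q : List (Fin n)}
    (hP : G.Best d m A v P) (hQ : G.Best d m A v Q) : P = Q := by
  by_contra hne
  exact (hP.2.2 Q hQ.1 hQ.2.1 (Ne.symm hne)).asymm (hQ.2.2 P hP.1 hP.2.1 hne)

theorem Greedy.total {A : Set (Fin n)} {v : Fin n} {P Q : List (Fin n)}
    (hP : G.Greedy d m A P) (hQ : G.Greedy d m A Q) (hPv : P.head? = some v)
    (hQv : Q.head? = some v) (hne : P ≠ Q) : G.Prefers P Q ∨ G.Prefers Q P := by
  by_cases h0 : v = d ∨ v = m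
  · exact absurd ((hP.1.eq_singleton hPv h0).trans (hQ.1.eq_singleton hQv h0).symm) hne
  · push Not at h0
    obtain ⟨u, P, rfl⟩ := hP.1.exists_cons_cons hPv h0.1 h0.2
    obtain ⟨u', Q, rfl⟩ := hQ.1.exists_cons_cons hQv h0.1 h0.2
    exact prefers_total (by simp) (by simp) (by simpa using hne)

/-- There are finitely many simple paths, so the strict order of preference has a minimal element
among the greedy routes from `v`; totality makes it the most preferred. -/
theorem Route.exists_best {A : Set (Fin n)} {v : Fin n} {P : List (Fin n)}
    (h : G.Route d m A P) (hv : P.head? = some v) : ∃ Q, G.Best d m A v Q := by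
  let α := {Q : List (Fin n) // G.Greedy d m A Q ∧ Q.head? = some v}
  have hfin : Finite α := by
    have : Finite {Q : List (Fin n) // Q.length ≤ n} := List.finite_length_le (Fin n) n
    refine Finite.of_injective
      (fun Q : α => (⟨Q.1, ?_⟩ : {Q : List (Fin n) // Q.length ≤ n})) ?_
    · simpa using Q.2.1.1.nodup.length_le_card
    · intro Q R hQR
      exact Subtype.ext (by simpa using hQR)
  have htr : IsTrans α (fun P Q => G.Prefers P.1 Q.1) := ⟨fun _ _ _ => Prefers.trans⟩
  have hir : Std.Irrefl (fun P Q : α => G.Prefers P.1 Q.1) := ⟨fun P => prefers_irrefl P.1⟩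
  have hwf := Finite.wellFounded_of_trans_of_irrefl (fun P Q : α => G.Prefers P.1 Q.1)
  obtain ⟨Q, hQ, hQd⟩ := h.exists_greedy
  obtain ⟨B, -, hB⟩ := hwf.has_min Set.univ ⟨⟨Q, hQ, hQd.trans hv⟩, trivial⟩
  refine ⟨B.1, B.2.1, B.2.2, fun R hR hRv hne => ?_⟩
  exact (B.2.1.total hR B.2.2 hRv hne.symm).resolve_right (hB ⟨R, hR, hRv⟩ trivial)

/-- Suppose `u` prefers a greedy route `Q` to its tail; both have the same class, so `Q` is not
longer. If `v` is not on `Q`, then `v :: Q` is greedy and preferred by `v`. If `v` is on `Q`, the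
suffix from `v` is a greedy route shorter than the best one of `v`. Both are impossible. -/
theorem Best.tail {A : Set (Fin n)} {v u : Fin n} {P : List (Fin n)}
    (h : G.Best d m A v (v :: u :: P)) : G.Best d m A u (u :: P) := by
  have hP : G.Greedy d m A (u :: P) := h.1.suffix (List.suffix_cons _ _) (by simp)
  refine ⟨hP, rfl, fun Q hQ hQu hne => ?_⟩
  refine (hP.total hQ rfl hQu hne.symm).resolve_right fun hpr => ?_
  have hc := hQ.pcls_eq hP (by simpa using hQu)
  have hl := hpr.length_le hc
  have hdm : v ≠ d ∧ v ≠ m := by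
    have := h.1.1
    cases this
    exact ⟨by assumption, by assumption⟩
  by_cases hvQ : v ∈ Q
  · obtain ⟨T, hT⟩ := exists_suffix_of_mem hvQ
    have hTg := hQ.suffix hT (by simp)
    have hlT := hT.length_le
    have hpr' := h.2.2 _ hTg rfl (by
      rintro h
      simp only [List.cons.injEq] at h
      rw [h.2] at hlT
      simp only [List.length_cons] at hlT hl
      omega)
    have := hpr'.length_le (h.1.pcls_eq hTg rfl)
    simp only [List.length_cons] at *
    omega
  · have hR := h.1.1.replace hQ.1 hQu (fun _ => hc.ge) hvQ
    have hcQ : G.pcls (v :: Q) = G.pcls (v :: u :: P) := by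
      obtain ⟨w, Q, rfl⟩ := List.exists_cons_of_ne_nil hQ.1.ne_nil
      simp only [List.head?_cons, Option.some.injEq] at hQu
      subst hQu
      rfl
    have hg : G.Greedy d m A (v :: Q) := hQ.cons hR fun R hR hRv => by
      rw [hcQ]
      exact h.1.2 _ List.suffix_rfl (by simp) R hR (by simpa using hRv)
    exact (h.2.2 _ hg rfl (by simpa using hne)).asymm
      (hpr.cons hc (by simpa using hQu))

theorem Best.suffix {A : Set (Fin n)} {v : Fin n} {P : List (Fin n)} (h : G.Best d m A v P)
    {u : Fin n} {T : List (Fin n)} (hT : (u :: T) <:+ P) : G.Best d m A u (u :: T) := by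
  induction P generalizing v with
  | nil => simp at hT
  | cons w P ih =>
    have hw : w = v := by simpa using h.2.1
    subst hw
    rcases List.suffix_cons_iff.1 hT with h' | h'
    · simp only [List.cons.injEq] at h'
      obtain ⟨rfl, rfl⟩ := h'
      exact h
    · cases P with
      | nil => simp at h'
      | cons x P => exact ih h.tail h'

/-! ### Stable states consist of the most preferred greedy routes -/

variable (G d m) in
open Classical in
/-- The state in which each vertex selects its most preferred greedy route. -/
noncomputable def bestState (A : Set (Fin n)) : State n := fun v =>
  if h : ∃ P, G.Best d m A v P then some h.choose else none

theorem bestState_eq_some {A : Set (Fin n)} {v : Fin n} {P : List (Fin n)} :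
    G.bestState d m A v = some P ↔ G.Best d m A v P := by
  unfold bestState
  split_ifs with h
  · simp only [Option.some.injEq]
    exact ⟨fun h' => h' ▸ h.choose_spec, fun h' => h.choose_spec.unique h'⟩
  · simp only [false_iff]
    exact fun h' => h ⟨P, h'⟩

theorem Candidate.route {A : Finset (Fin n)} {S : State n}
    (hS : ∀ u P, u ≠ m → S u = some P → G.Best d m A u P)
    {v : Fin n} (hd : v ≠ d) (hm : v ≠ m) {P : List (Fin n)} (h : G.Candidate m A S v P) :
    ∃ Q, P = v :: Q ∧ G.Route d m A (v :: Q) ∧ G.Greedy d m A Q := by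
  obtain ⟨u, Q, ⟨hl, h⟩, hv, rfl⟩ := h
  refine ⟨Q, rfl, ?_⟩
  rcases h with ⟨rfl, hA, rfl⟩ | ⟨hum, hSu, hvf⟩
  · exact ⟨.cons .fake hv hd hm (by simpa [ValleyFree] using hl) fun _ => by simpa using hA,
      .singleton .fake⟩
  · have hb := hS u Q hum hSu
    refine ⟨.cons hb.1.1 hv hd hm hvf fun h => ?_, hb.1⟩
    subst h
    exact absurd (by simpa using hb.2.1) hum.symm

/-- The best route of `v` is a candidate because its tail is best for the next hop. Any other
candidate has a greedy tail; it either has a worse class, or is itself greedy and loses by the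
choice of the best route. -/
theorem stable_bestState (hdm : d ≠ m) (A : Finset (Fin n)) :
    G.Stable d m A (G.bestState d m A) := by
  constructor
  · rw [bestState_eq_some]
    exact ⟨.singleton .dest, rfl, fun Q hQ hQd hne =>
      absurd (hQ.1.eq_singleton hQd (Or.inl rfl)) hne⟩
  · intro v hd hm
    have hS : ∀ u P, u ≠ m → G.bestState d m A u = some P → G.Best d m A u P :=
      fun u P _ h => bestState_eq_some.1 h
    by_cases h : ∃ P, G.Best d m A v P
    · obtain ⟨P, hP⟩ := h
      refine Or.inr ⟨P, bestState_eq_some.2 hP, ?_, fun Q hQ hne => ?_⟩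
      · obtain ⟨u, T, rfl⟩ := hP.1.1.exists_cons_cons hP.2.1 hd hm
        have ht := hP.tail
        have hr := hP.1.1
        have hvf := valleyFree_cons_cons.1 hr.valleyFree
        refine ⟨u, u :: T, ⟨hvf.1, ?_⟩, ?_, rfl⟩
        · by_cases hu : u = m
          · subst hu
            have h0 := ht.1.1.eq_singleton rfl (Or.inr rfl)
            refine Or.inl ⟨rfl, ?_, h0⟩
            cases hr with
            | cons _ _ _ _ _ h => exact h h0
          · exact Or.inr ⟨hu, bestState_eq_some.2 ht, hr.valleyFree⟩
        · exact (List.nodup_cons.1 hr.nodup).1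
      · obtain ⟨Q, rfl, hr, hg⟩ := hQ.route hS hd hm
        rcases lt_or_eq_of_le (hP.1.2 P List.suffix_rfl hP.1.1.ne_nil _ hr
          (by simpa using hP.2.1.symm)) with hc | hc
        · obtain ⟨u, T, rfl⟩ := hP.1.1.exists_cons_cons hP.2.1 hd hm
          obtain ⟨w, Q, rfl⟩ := List.exists_cons_of_ne_nil hg.1.ne_nil
          exact prefers_of_pcls hc
        · refine hP.2.2 _ (hg.cons hr fun R hR hRv => ?_) rfl hne
          rw [hc]
          exact hP.1.2 P List.suffix_rfl hP.1.1.ne_nil _ hR (hRv.trans hP.2.1.symm)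
    · refine Or.inl ⟨?_, fun Q hQ => ?_⟩
      · cases hb : G.bestState d m A v with
        | none => rfl
        | some P => exact absurd ⟨P, bestState_eq_some.1 hb⟩ h
      · obtain ⟨Q, rfl, hr, hg⟩ := hQ.route hS hd hm
        exact h (hr.exists_best rfl)

/-- The path that `v` announces: `m` pretends to be an origin. -/
def Selected (m : Fin n) (S : State n) (v : Fin n) (P : List (Fin n)) : Prop :=
  (v = m ∧ P = [m]) ∨ (v ≠ m ∧ S v = some P)

theorem Selected.unique {S : State n} {v : Fin n} {P Q : List (Fin n)}
    (hP : Selected m S v P) (hQ : Selected m S v Q) : P = Q := by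
  rcases hP with ⟨h1, h2⟩ | ⟨h1, h2⟩ <;> rcases hQ with ⟨h3, h4⟩ | ⟨h3, h4⟩
  · rw [h2, h4]
  · exact absurd h1 h3
  · exact absurd h3 h1
  · exact Option.some.inj (h2.symm.trans h4)

/-- A selected path is a candidate, so its next hop announces, and hence has selected, the tail.
Induction on the length carries this down the whole path. -/
theorem Stable.selected {A : Finset (Fin n)} {S : State n} (hS : G.Stable d m A S) :
    ∀ {P : List (Fin n)} {v : Fin n}, Selected m S v P →
      G.Route d m A P ∧ P.head? = some v ∧
        ∀ u T, (u :: T) <:+ P → Selected m S u (u :: T) := by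
  intro P
  induction hl : P.length using Nat.strong_induction_on generalizing P with
  | _ l ih =>
    intro v h
    have single : ∀ w, Selected m S w [w] → ∀ u T, (u :: T) <:+ [w] →
        Selected m S u (u :: T) := by
      intro w hw u T hT
      rcases List.suffix_cons_iff.1 hT with h' | h'
      · simp only [List.cons.injEq] at h'
        obtain ⟨rfl, rfl⟩ := h'
        exact hw
      · simp at h'
    have h' := h
    rcases h with ⟨rfl, rfl⟩ | ⟨hm, h⟩
    · exact ⟨.fake, rfl, single _ h'⟩
    by_cases hd : v = d
    · subst hd
      obtain rfl : [v] = P := Option.some.inj (hS.1.symm.trans h)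
      exact ⟨.dest, rfl, single _ h'⟩
    rcases hS.2 v hd hm with ⟨h0, -⟩ | ⟨P', hP', ⟨u, Q, ⟨hlk, hann⟩, hv, rfl⟩, -⟩
    · rw [h0] at h; simp at h
    obtain rfl : v :: Q = P := Option.some.inj (hP'.symm.trans h)
    have hsel : Selected m S u Q := by
      rcases hann with ⟨h1, -, h2⟩ | ⟨h1, h2, -⟩
      · exact Or.inl ⟨h1, h2⟩
      · exact Or.inr ⟨h1, h2⟩
    obtain ⟨i1, i2, i3⟩ := ih Q.length (by simp [← hl]) rfl hsel
    refine ⟨?_, rfl, fun w T hT => ?_⟩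
    · refine .cons i1 hv hd hm ?_ ?_
      · rcases hann with ⟨h1, -, rfl⟩ | ⟨h1, h2, h3⟩
        · subst h1; simpa [ValleyFree] using hlk
        · exact h3
      · rintro rfl
        rcases hann with ⟨h1, h2, -⟩ | ⟨h1, h2, -⟩
        · simpa using h2
        · exact absurd (by simpa using i2) h1.symm
    · rcases List.suffix_cons_iff.1 hT with h4 | h4
      · simp only [List.cons.injEq] at h4
        obtain ⟨rfl, rfl⟩ := h4
        exact h'
      · exact i3 w T h4

theorem Stable.improve {A : Finset (Fin n)} {S : State n} (hS : G.Stable d m A S)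
    {v u : Fin n} {Q : List (Fin n)} (hu : Selected m S u Q) (h : G.Route d m A (v :: Q)) :
    ∃ P, Selected m S v P ∧ (P = v :: Q ∨ G.Prefers P (v :: Q)) := by
  have hq := hS.selected hu
  cases h with
  | dest => exact absurd rfl hq.1.ne_nil
  | fake => exact absurd rfl hq.1.ne_nil
  | cons hQ hv hd hm hvf hA =>
    obtain ⟨w, Q, rfl⟩ := List.exists_cons_of_ne_nil hQ.ne_nil
    have hw : w = u := by simpa using hq.2.1
    subst hw
    have hcand : G.Candidate m A S v (v :: w :: Q) := by
      refine ⟨w, w :: Q, ⟨(valleyFree_cons_cons.1 hvf).1, ?_⟩, hv, rfl⟩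
      rcases hu with ⟨rfl, h2⟩ | ⟨h1, h2⟩
      · exact Or.inl ⟨rfl, by simpa using hA h2, h2⟩
      · exact Or.inr ⟨h1, h2, hvf⟩
    rcases hS.2 v hd hm with ⟨-, h0⟩ | ⟨P, hP, -, hbest⟩
    · exact absurd hcand (h0 _)
    · refine ⟨P, Or.inr ⟨hm, hP⟩, ?_⟩
      by_cases he : v :: w :: Q = P
      · exact Or.inl he.symm
      · exact Or.inr (hbest _ hcand he)

/-- By induction along the route the next hop `u` has selected some `Q` of sufficient class. If `v`
is not on `Q`, then `v :: Q` is a candidate of the required class. If it is, `v` has selected a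
suffix of `Q`; when the step to `u` needs more than class `1`, `Q` is trivial, which is absurd, or
of class `3`, and then so is the suffix. -/
theorem Stable.exists_selected {A : Finset (Fin n)} {S : State n} (hdm : d ≠ m)
    (hS : G.Stable d m A S) {R : List (Fin n)} (hR : G.Route d m A R) :
    ∀ {v : Fin n}, R.head? = some v → ∃ P, Selected m S v P ∧ G.pcls R ≤ G.pcls P := by
  induction hR with
  | dest =>
    intro v hv
    obtain rfl : d = v := by simpa using hv
    exact ⟨[d], Or.inr ⟨hdm, hS.1⟩, le_rfl⟩
  | fake =>
    intro v hv
    obtain rfl : m = v := by simpa using hv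
    exact ⟨[m], Or.inl ⟨rfl, rfl⟩, le_rfl⟩
  | @cons v R hR hv hd hm hvf hA ih =>
    intro v' hv'
    obtain rfl : v = v' := by simpa using hv'
    have hR0 : G.Route d m A (v :: R) := .cons hR hv hd hm hvf hA
    obtain ⟨u, R, rfl⟩ := List.exists_cons_of_ne_nil hR.ne_nil
    obtain ⟨Q, hQ, hc⟩ := ih rfl
    obtain ⟨q1, q2, q3⟩ := hS.selected hQ
    by_cases hvQ : v ∈ Q
    · obtain ⟨T, hT⟩ := exists_suffix_of_mem hvQ
      refine ⟨v :: T, q3 v T hT, ?_⟩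
      have hrT := q1.suffix hT (by simp)
      by_cases hp : G.link v u = Link.provider
      · have := hrT.pcls_pos rfl hd hm
        simpa [pcls, hp, Link.cls] using this
      · obtain ⟨w, T, h2⟩ := hrT.exists_cons_cons rfl hd hm
        simp only [List.cons.injEq, true_and] at h2
        subst h2
        rcases (valleyFree_cons_cons.1 hvf).2.1 hp with rfl | h3
        · rw [q1.eq_singleton q2 hR.origin_of_singleton] at hvQ
          exact absurd hvQ hv
        · rw [q1.pcls_suffix (le_antisymm (pcls_le _) (h3 ▸ hc)) hT (by simp)]
          exact pcls_le _
    · obtain ⟨P, hP, h⟩ := hS.improve hQ (hR0.replace q1 q2 (fun _ => hc) hvQ)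
      refine ⟨P, hP, ?_⟩
      have hcQ : G.pcls (v :: u :: R) = G.pcls (v :: Q) := by
        obtain ⟨w, Q, rfl⟩ := List.exists_cons_of_ne_nil q1.ne_nil
        simp only [List.head?_cons, Option.some.injEq] at q2
        subst q2
        rfl
      rw [hcQ]
      rcases h with rfl | h
      · rfl
      · exact h.pcls_le

theorem Stable.greedy {A : Finset (Fin n)} {S : State n} (hdm : d ≠ m)
    (hS : G.Stable d m A S) {v : Fin n} {P : List (Fin n)} (h : Selected m S v P) :
    G.Greedy d m A P := by
  obtain ⟨h1, h2, h3⟩ := hS.selected h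
  refine ⟨h1, fun T hT h0 R hR hd => ?_⟩
  obtain ⟨x, T, rfl⟩ := List.exists_cons_of_ne_nil h0
  obtain ⟨P', hP', hc⟩ := hS.exists_selected hdm hR hd
  rwa [hP'.unique (h3 x T hT)] at hc

/-- Induction on the competitor `v :: u :: R`. The selection `T` of `u` is `u :: R` or preferred to
it, of equal class and hence not longer. If `v` is on `T`, the selection of `v` is a suffix of `T`,
shorter than the competitor. Otherwise `v` does at least as well as `v :: T`, and `Prefers.cons`
compares that with the competitor. -/
theorem Stable.best {A : Finset (Fin n)} {S : State n} (hdm : d ≠ m)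
    (hS : G.Stable d m A S) {v : Fin n} {P : List (Fin n)} (h : Selected m S v P) :
    G.Best d m A v P := by
  refine ⟨hS.greedy hdm h, (hS.selected h).2.1, fun Q hQ hQv hne => ?_⟩
  have hQr := hQ.1
  induction hQr generalizing v P with
  | dest => exact absurd ((hS.selected h).1.eq_singleton (hS.selected h).2.1 (Or.inl
      (by simpa using hQv.symm))).symm (by simp_all)
  | fake => exact absurd ((hS.selected h).1.eq_singleton (hS.selected h).2.1 (Or.inr
      (by simpa using hQv.symm))).symm (by simp_all)
  | @cons v' R hR hv hd hm hvf hA ih =>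
    obtain rfl : v' = v := by simpa using hQv
    have hRg : G.Greedy d m A R := hQ.suffix (List.suffix_cons _ _) hR.ne_nil
    obtain ⟨u, R, rfl⟩ := List.exists_cons_of_ne_nil hR.ne_nil
    obtain ⟨T, hT, -⟩ := hS.exists_selected hdm hR (v := u) rfl
    have hTg := hS.greedy hdm hT
    obtain ⟨t1, t2, t3⟩ := hS.selected hT
    have hc : G.pcls T = G.pcls (u :: R) := hTg.pcls_eq hRg (by simpa using t2)
    have hl : T.length ≤ (u :: R).length := by
      by_cases he : u :: R = T
      · rw [he]
      · exact (ih hT hRg rfl he).length_le hc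
    by_cases hvT : v' ∈ T
    · obtain ⟨U, hU⟩ := exists_suffix_of_mem hvT
      have hPU : P = v' :: U := h.unique (t3 _ _ hU)
      have hUl := hU.length_le
      have hPg := hS.greedy hdm h
      obtain ⟨w, W, rfl⟩ := hPg.1.exists_cons_cons (v := v') (by rw [hPU]; rfl) hd hm
      refine prefers_of_length (hPg.pcls_eq hQ rfl) ?_
      rw [← hPU] at hUl
      simp only [List.length_cons] at hUl hl
      omega
    · obtain ⟨P', hP', h'⟩ := hS.improve hT (hQ.1.replace t1 t2 (fun _ => hc.ge) hvT)
      obtain rfl := hP'.unique h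
      by_cases he : u :: R = T
      · rw [he] at hne ⊢
        exact h'.resolve_left hne.symm
      · have h2 : G.Prefers (v' :: T) (v' :: u :: R) :=
          (ih hT hRg rfl he).cons hc (by simpa using t2)
        rcases h' with rfl | h'
        · exact h2
        · exact h'.trans h2

end Network

theorem HijackInput.hijack_iff (I : HijackInput) : I.Hijack ↔
    ∃ A : Finset (Fin I.n), (∀ v ∈ A, I.G.link I.m v ≠ Link.none) ∧
      ∃ P, I.G.Best I.d I.m A I.s P ∧ P.getLast? = some I.m := by
  refine exists_congr fun A => and_congr_right fun hA => ⟨?_, ?_⟩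
  · rintro ⟨S, hS, P, hP, hl⟩
    exact ⟨P, hS.best I.d_ne_m (Or.inr ⟨I.s_ne_m, hP⟩), hl⟩
  · rintro ⟨P, hP, hl⟩
    exact ⟨_, Network.stable_bestState I.d_ne_m A, P, Network.bestState_eq_some.2 hP, hl⟩


/-! ### Sublists selected by a property -/

open Classical in
/-- The elements of `l` with the property `p`, in reverse order. -/
noncomputable def select {α : Type*} (p : α → Prop) (l : List α) : List α :=
  l.foldl (fun acc x => if p x then x :: acc else acc) []

theorem foldl_select {α : Type*} (p : α → Prop) [DecidablePred p] (l acc : List α) :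
    l.foldl (fun acc x => if p x then x :: acc else acc) acc = (l.filter p).reverse ++ acc := by
  induction l generalizing acc with
  | nil => simp
  | cons a l ih => by_cases h : p a <;> simp [ih, h]

open Classical in
theorem select_eq {α : Type*} (p : α → Prop) (l : List α) :
    select p l = (l.filter p).reverse := by
  simp [select, foldl_select]

@[simp]
theorem mem_select {α : Type*} {p : α → Prop} {l : List α} {x : α} :
    x ∈ select p l ↔ x ∈ l ∧ p x := by
  classical simp [select_eq]

theorem length_select_le {α : Type*} (p : α → Prop) (l : List α) :
    (select p l).length ≤ l.length := by
  classical simpa [select_eq] using List.length_filter_le _ l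

theorem forall_of_length_select {α : Type*} {p : α → Prop} {l : List α}
    (h : l.length ≤ (select p l).length) : ∀ x ∈ l, p x := by
  classical
  have h' : (l.filter p).length = l.length :=
    le_antisymm (List.length_filter_le _ l) (by simpa [select_eq] using h)
  simpa using List.length_filter_eq_length_iff.1 h'

/-! ### Pruning the announcements of `m` for a fixed target path -/

namespace Network

variable {n : ℕ} (G : Network n) (d m : Fin n)

/-- The next hop of a path (`d` if there is none). -/
def hop (P : List (Fin n)) : Fin n := P.tail.headD d

/-- `Q` is better than `P` by class, length and next hop. -/
def LocalPref (Q P : List (Fin n)) : Prop :=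
  G.pcls P < G.pcls Q ∨ (G.pcls P = G.pcls Q ∧
    (Q.length < P.length ∨ (Q.length = P.length ∧ hop d Q < hop d P)))

/-- `Q` is locally better than a suffix of `p` from the same vertex. -/
def Beats (p Q : List (Fin n)) : Prop :=
  ∃ T, T <:+ p ∧ T ≠ [] ∧ Q.headD d = T.headD d ∧ G.LocalPref d Q T

/-- The elements `a` of `A` such that no greedy route through `a` beats `p`. -/
noncomputable def prune (p A : List (Fin n)) : List (Fin n) :=
  select (fun a => ¬ ∃ Q, G.Greedy d m {x | x ∈ A} Q ∧ G.Beats d p Q ∧ [a, m] <:+ Q) A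

variable {G d m}

theorem headD_eq_iff {P Q : List (Fin n)} (hP : P ≠ []) (hQ : Q ≠ []) :
    P.headD d = Q.headD d ↔ P.head? = Q.head? := by
  obtain ⟨x, P, rfl⟩ := List.exists_cons_of_ne_nil hP
  obtain ⟨y, Q, rfl⟩ := List.exists_cons_of_ne_nil hQ
  simp

/-- The set `A` matters only at the vertex just before a final `m`. One list of routes, computed for
`Set.univ`, therefore serves all sets. -/
theorem route_iff {A : Set (Fin n)} {R : List (Fin n)} : G.Route d m A R ↔
    G.Route d m Set.univ R ∧ ∀ a, [a, m] <:+ R → a ∈ A := by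
  constructor
  · intro h
    refine ⟨h.mono (Set.subset_univ _), fun a ha => ?_⟩
    cases h.suffix ha (by simp) with
    | cons _ _ _ _ _ h => exact h rfl
  · rintro ⟨h, hA⟩
    induction h with
    | dest => exact .dest
    | fake => exact .fake
    | cons hP hv hd hm hvf _ ih =>
      refine .cons (ih fun a ha => hA a (ha.trans (List.suffix_cons _ _))) hv hd hm hvf ?_
      rintro rfl
      exact hA _ List.suffix_rfl

theorem Route.end_cases {A : Set (Fin n)} {R : List (Fin n)} (h : G.Route d m A R) :
    R = [m] ∨ G.Route d m ∅ R ∨ ∃ a ∈ A, [a, m] <:+ R := by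
  by_cases ha : ∃ a ∈ A, [a, m] <:+ R
  · exact Or.inr (Or.inr ha)
  · refine Or.inr (Or.inl (route_iff.2 ⟨(route_iff.1 h).1, fun a h' => ?_⟩))
    exact absurd ⟨a, (route_iff.1 h).2 a h', h'⟩ ha

theorem LocalPref.prefers {v : Fin n} {P Q : List (Fin n)} (hP : P ≠ []) (hQ : Q ≠ [])
    (h : G.LocalPref d (v :: Q) (v :: P)) : G.Prefers (v :: Q) (v :: P) := by
  obtain ⟨x, P, rfl⟩ := List.exists_cons_of_ne_nil hP
  obtain ⟨y, Q, rfl⟩ := List.exists_cons_of_ne_nil hQ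
  rw [prefers_cons_cons]
  simp only [LocalPref, pcls, hop, List.tail_cons, List.headD_cons, List.length_cons] at h
  omega

theorem localPref_irrefl (P : List (Fin n)) : ¬ G.LocalPref d P P := by
  simp [LocalPref]

theorem Best.not_beats {A : Set (Fin n)} {v : Fin n} {p Q : List (Fin n)}
    (hp : G.Best d m A v p) (hQ : G.Greedy d m A Q) : ¬ G.Beats d p Q := by
  rintro ⟨T, hT, h0, hd, hpr⟩
  rw [headD_eq_iff hQ.1.ne_nil h0] at hd
  obtain ⟨u, T, rfl⟩ := List.exists_cons_of_ne_nil h0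
  have hb := hp.suffix hT
  by_cases he : Q = u :: T
  · rw [he] at hpr
    exact localPref_irrefl _ hpr
  · by_cases hu : u = d ∨ u = m
    · exact he ((hQ.1.eq_singleton hd hu).trans (hb.1.1.eq_singleton rfl hu).symm)
    · push Not at hu
      obtain ⟨w, W, rfl⟩ := hQ.1.exists_cons_cons hd hu.1 hu.2
      obtain ⟨x, X, h⟩ := hb.1.1.exists_cons_cons rfl hu.1 hu.2
      simp only [List.cons.injEq, true_and] at h
      subst h
      exact (hb.2.2 _ hQ hd he).asymm (hpr.prefers (by simp) (by simp))

/-- As long as class, length and next hop agree, the comparison is handed on to the next hop; it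
ends at a common vertex where one of the three decides. This is why `Beats` looks at suffixes. -/
theorem exists_localPref {P Q : List (Fin n)} (h : G.Prefers Q P) (hd : Q.head? = P.head?) :
    ∃ Q' P', Q' <:+ Q ∧ P' <:+ P ∧ Q' ≠ [] ∧ P' ≠ [] ∧ Q'.head? = P'.head? ∧
      G.LocalPref d Q' P' := by
  induction Q generalizing P with
  | nil => simp [Prefers] at h
  | cons v Q ih =>
    obtain ⟨_, u, Q, v', u', P, h', rfl⟩ := h.exists_cons
    simp only [List.cons.injEq] at h'
    obtain ⟨rfl, rfl⟩ := h'
    by_cases hl : G.LocalPref d (v :: u :: Q) (v' :: u' :: P)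
    · exact ⟨_, _, List.suffix_rfl, List.suffix_rfl, by simp, by simp, hd, hl⟩
    · rw [prefers_cons_cons] at h
      simp only [LocalPref, pcls, hop, List.tail_cons, List.headD_cons, List.length_cons] at hl
      have hu : u = u' ∧ G.Prefers (u :: Q) (u' :: P) := by
        rcases h with h | ⟨h1, h | ⟨h2, h | h⟩⟩
        · omega
        · omega
        · omega
        · exact h
      obtain ⟨rfl, hpr⟩ := hu
      obtain ⟨Q', P', h1, h2, h3⟩ := ih hpr rfl
      exact ⟨Q', P', h1.trans (List.suffix_cons _ _), h2.trans (List.suffix_cons _ _), h3⟩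

/-- If a suffix had less than the best class, `Route.exists_greedy` would provide a greedy route
beating it by class. If a greedy route were preferred to `p`, one of its suffixes would beat `p` by
`exists_localPref`. -/
theorem best_of_not_beats {A : Set (Fin n)} {v : Fin n} {p : List (Fin n)}
    (hp : G.Route d m A p) (hv : p.head? = some v)
    (h : ∀ Q, G.Greedy d m A Q → ¬ G.Beats d p Q) : G.Best d m A v p := by
  have key : ∀ Q' P', G.Greedy d m A Q' → P' <:+ p → P' ≠ [] → Q'.head? = P'.head? →
      ¬ G.LocalPref d Q' P' := fun Q' P' hQ hP h0 hd hl =>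
    h Q' hQ ⟨P', hP, h0, (headD_eq_iff hQ.1.ne_nil h0).2 hd, hl⟩
  have hg : G.Greedy d m A p := by
    refine ⟨hp, fun T hT h0 R hR hd => ?_⟩
    by_contra hlt
    push Not at hlt
    obtain ⟨Q, hQ, hQd⟩ := hR.exists_greedy
    exact key Q T hQ hT h0 (hQd.trans hd) (Or.inl (hlt.trans_le
      (hQ.2 Q List.suffix_rfl hQ.1.ne_nil R hR hQd.symm)))
  refine ⟨hg, hv, fun Q hQ hQv hne => (hg.total hQ hv hQv hne.symm).resolve_right fun hpr => ?_⟩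
  obtain ⟨Q', P', h1, h2, h3, h4, h5, h6⟩ := exists_localPref (d := d) hpr (hQv.trans hv.symm)
  exact key Q' P' (hQ.suffix h1 h3) h2 h4 h5 h6

/-- A route that causes the deletion of `a ∈ A` reaches `m` through `a`, so it is a route for `A` as
well and stays greedy there; beating `p`, it contradicts that `p` is best for `A`. -/
theorem Best.subset_prune {A : Set (Fin n)} {v : Fin n} {p B : List (Fin n)}
    (hp : G.Best d m A v p) (hAB : A ⊆ {x | x ∈ B}) : A ⊆ {x | x ∈ G.prune d m p B} := by
  intro a ha
  refine mem_select.2 ⟨hAB ha, ?_⟩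
  rintro ⟨Q, hQ, hbt, hs⟩
  refine hp.not_beats (hQ.anti hAB ?_) hbt
  refine route_iff.2 ⟨(route_iff.1 hQ.1).1, fun b hb => ?_⟩
  have : [b, m] = [a, m] := by
    rcases List.suffix_or_suffix_of_suffix hb hs with h | h
    · exact h.eq_of_length rfl
    · exact (h.eq_of_length rfl).symm
  obtain rfl : b = a := by simpa using this
  exact ha

theorem Best.subset_iterate_prune {A : Set (Fin n)} {v : Fin n} {p B : List (Fin n)}
    (hp : G.Best d m A v p) (hAB : A ⊆ {x | x ∈ B}) (i : ℕ) :
    A ⊆ {x | x ∈ (G.prune d m p)^[i] B} := by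
  induction i with
  | zero => exact hAB
  | succ i ih => rw [Function.iterate_succ_apply']; exact hp.subset_prune ih

theorem length_iterate_prune (p B : List (Fin n)) (i : ℕ) :
    ((G.prune d m p)^[i] B).length ≤ B.length := by
  induction i with
  | zero => exact le_rfl
  | succ i ih =>
    rw [Function.iterate_succ_apply']
    exact (length_select_le _ _).trans ih

theorem iterate_prune_subset (p B : List (Fin n)) (i : ℕ) :
    (G.prune d m p)^[i] B ⊆ B := by
  induction i with
  | zero => exact List.Subset.refl _
  | succ i ih =>
    rw [Function.iterate_succ_apply']
    exact fun x hx => ih (mem_select.1 hx).1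

/-- After enough rounds of pruning, no greedy route through `m` beats `p`. -/
theorem iterate_prune_stable (p B : List (Fin n)) (i : ℕ) (hi : B.length ≤ i) :
    ∀ a ∈ (G.prune d m p)^[i] B, ¬ ∃ Q, G.Greedy d m {x | x ∈ (G.prune d m p)^[i] B} Q ∧
      G.Beats d p Q ∧ [a, m] <:+ Q := by
  have step : ∀ C : List (Fin n), (∀ a ∈ C, ¬ ∃ Q, G.Greedy d m {x | x ∈ C} Q ∧
      G.Beats d p Q ∧ [a, m] <:+ Q) ∨ (G.prune d m p C).length < C.length := by
    intro C
    by_cases h : C.length ≤ (G.prune d m p C).length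
    · exact Or.inl (forall_of_length_select h)
    · exact Or.inr (by omega)
  have stable : ∀ C : List (Fin n), (∀ a ∈ C, ¬ ∃ Q, G.Greedy d m {x | x ∈ C} Q ∧
      G.Beats d p Q ∧ [a, m] <:+ Q) → ∀ x, x ∈ G.prune d m p C ↔ x ∈ C := by
    intro C hC x
    exact ⟨fun h => (mem_select.1 h).1, fun h => mem_select.2 ⟨h, hC x h⟩⟩
  -- Until a fixed point is reached every round removes an element, so after `i` such rounds at most
  -- `B.length - i` are left. For `i ≥ B.length` the list is empty.
  have main : ∀ i, (∀ a ∈ (G.prune d m p)^[i] B, ¬ ∃ Q,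
      G.Greedy d m {x | x ∈ (G.prune d m p)^[i] B} Q ∧ G.Beats d p Q ∧ [a, m] <:+ Q) ∨
      ((G.prune d m p)^[i] B).length + i < B.length + 1 := by
    intro i
    induction i with
    | zero => right; simp
    | succ i ih =>
      rw [Function.iterate_succ_apply']
      rcases ih with h | h
      · left
        have hst := stable _ h
        have hset : {x | x ∈ G.prune d m p ((G.prune d m p)^[i] B)} =
          {x | x ∈ (G.prune d m p)^[i] B} := Set.ext hst
        rw [hset]
        exact fun a ha => h a ((hst a).1 ha)
      · rcases step ((G.prune d m p)^[i] B) with h' | h'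
        · left
          have hst := stable _ h'
          have hset : {x | x ∈ G.prune d m p ((G.prune d m p)^[i] B)} =
            {x | x ∈ (G.prune d m p)^[i] B} := Set.ext hst
          rw [hset]
          exact fun a ha => h' a ((hst a).1 ha)
        · right; omega
  rcases main i with h | h
  · exact h
  · have h0 : ((G.prune d m p)^[i] B).length = 0 := by omega
    rw [List.length_eq_zero_iff.1 h0]
    simp

/-- A greedy route for the pruned set that does not use an announcement of `m` is also greedy for
`A` and cannot beat `p`; for one that does, the pruning has come to rest. -/
theorem Best.iterate_prune_not_beats {A : Set (Fin n)} {v : Fin n} {p B : List (Fin n)}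
    (hp : G.Best d m A v p) (hAB : A ⊆ {x | x ∈ B}) (i : ℕ) (hi : B.length ≤ i) {Q}
    (hQ : G.Greedy d m {x | x ∈ (G.prune d m p)^[i] B} Q) : ¬ G.Beats d p Q := by
  intro hbt
  have hsub := hp.subset_iterate_prune hAB i
  rcases hQ.1.end_cases with h | h | ⟨a, ha, hs⟩
  · subst h
    exact hp.not_beats (hQ.anti hsub .fake) hbt
  · exact hp.not_beats (hQ.anti hsub (h.mono (Set.empty_subset _))) hbt
  · exact iterate_prune_stable p B i hi a ha ⟨Q, hQ, hbt, hs⟩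

theorem getLast?_eq_some_iff_suffix {P : List (Fin n)} :
    P.getLast? = some m ↔ [m] <:+ P := by
  rw [List.getLast?_eq_some_iff]
  exact exists_congr fun _ => eq_comm

end Network

/-! ### HIJACK as a search over target paths -/

namespace HijackInput

open Network

/-- The vertices of the network. -/
def verts (I : HijackInput) : List (Fin I.n) := (List.finRange I.n).reverse

theorem mem_verts (I : HijackInput) (v : Fin I.n) : v ∈ I.verts := by simp [verts]

theorem length_verts (I : HijackInput) : I.verts.length = I.n := by simp [verts]

/-- The vertices to which `m` announces itself if it aims at the path `p`. -/
noncomputable def target (I : HijackInput) (p : List (Fin I.n)) : List (Fin I.n) :=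
  (I.G.prune I.d I.m p)^[I.n] (select (fun v => I.G.link I.m v ≠ Link.none) I.verts)

/-- If `p` is best for `A`, the pruned set contains `A`; so `p` is still a route, and it is
unbeaten. Conversely the pruned set itself is the required set of neighbours. -/
theorem hijack_iff_target (I : HijackInput) : I.Hijack ↔
    ∃ p, I.G.Route I.d I.m Set.univ p ∧ p.headD I.d = I.s ∧ [I.m] <:+ p ∧
      I.G.Route I.d I.m {x | x ∈ I.target p} p ∧
      ¬ ∃ Q, I.G.Greedy I.d I.m {x | x ∈ I.target p} Q ∧ I.G.Beats I.d p Q := by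
  rw [hijack_iff]
  constructor
  · rintro ⟨A, hA, p, hp, hl⟩
    have hAB : (A : Set (Fin I.n)) ⊆
        {x | x ∈ select (fun v => I.G.link I.m v ≠ Link.none) I.verts} :=
      fun v hv => mem_select.2 ⟨I.mem_verts v, hA v hv⟩
    refine ⟨p, hp.1.1.mono (Set.subset_univ _), ?_, ?_,
      hp.1.1.mono (hp.subset_iterate_prune hAB _), ?_⟩
    · rw [List.headD_eq_head?_getD, hp.2.1]; rfl
    · exact getLast?_eq_some_iff_suffix.1 hl
    · rintro ⟨Q, hQ, hbt⟩
      exact hp.iterate_prune_not_beats hAB I.n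
        ((length_select_le _ _).trans I.length_verts.le) hQ hbt
  · rintro ⟨p, -, hs, hl, hr, hbt⟩
    refine ⟨(I.target p).toFinset, fun v hv => ?_, p, ?_, getLast?_eq_some_iff_suffix.2 hl⟩
    · exact (mem_select.1 (iterate_prune_subset _ _ _ (List.mem_toFinset.1 hv))).2
    · rw [show (((I.target p).toFinset : Finset (Fin I.n)) : Set (Fin I.n)) =
        {x | x ∈ I.target p} from by ext; simp]
      refine best_of_not_beats hr ?_ fun Q hQ h => hbt ⟨Q, hQ, h⟩
      obtain ⟨x, p, rfl⟩ := List.exists_cons_of_ne_nil hr.ne_nil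
      simpa using hs

end HijackInput
end BGP

/-! ### Polynomially bounded programs and their composition -/

namespace WhileProg

/-- `T` is bounded by a polynomial in `μ`. -/
def PolyBound {Γ : Type} (μ T : Γ → ℕ) : Prop := ∃ e : ℕ, ∀ a, T a ≤ (μ a + 2) ^ e

namespace PolyBound

variable {Γ : Type} {μ : Γ → ℕ}

theorem mono {S T : Γ → ℕ} (h : PolyBound μ T) (hST : ∀ a, S a ≤ T a) : PolyBound μ S :=
  h.imp fun _ he a => (hST a).trans (he a)

/-- The base `μ a + 2` is at least `2`, and `c < 2 ^ c`. -/
theorem const (c : ℕ) : PolyBound μ fun _ => c :=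
  ⟨c, fun a => (Nat.lt_two_pow_self).le.trans (Nat.pow_le_pow_left (by omega) c)⟩

theorem self : PolyBound μ μ := ⟨1, fun a => by rw [pow_one]; omega⟩

theorem mul {S T : Γ → ℕ} (hS : PolyBound μ S) (hT : PolyBound μ T) :
    PolyBound μ fun a => S a * T a := by
  obtain ⟨e, he⟩ := hS
  obtain ⟨f, hf⟩ := hT
  exact ⟨e + f, fun a => by rw [pow_add]; exact Nat.mul_le_mul (he a) (hf a)⟩

theorem add {S T : Γ → ℕ} (hS : PolyBound μ S) (hT : PolyBound μ T) :
    PolyBound μ fun a => S a + T a := by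
  obtain ⟨e, he⟩ := hS
  obtain ⟨f, hf⟩ := hT
  refine ⟨e + f + 1, fun a => ?_⟩
  have h1 : (μ a + 2) ^ e ≤ (μ a + 2) ^ (e + f) := Nat.pow_le_pow_right (by omega) (by omega)
  have h2 : (μ a + 2) ^ f ≤ (μ a + 2) ^ (e + f) := Nat.pow_le_pow_right (by omega) (by omega)
  have h3 : (μ a + 2) ^ (e + f + 1) = (μ a + 2) ^ (e + f) * (μ a + 2) := pow_succ _ _
  nlinarith [he a, hf a]

theorem comap {S : Γ → ℕ} (h : PolyBound μ S) {Δ : Type} (f : Δ → Γ) :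
    PolyBound (fun x => μ (f x)) fun x => S (f x) :=
  h.imp fun _ he x => he (f x)

end PolyBound

/-- Some program turns the tree `u a` into the tree `v a`, in a number of steps polynomial in
`μ a`.  The program exists for every register that is to hold input and output, and it does not
change the registers below. -/
def Computes {Γ : Type} (μ : Γ → ℕ) (u v : Γ → Tree) : Prop :=
  ∃ (P : ℕ → Cmd) (T : Γ → ℕ), PolyBound μ T ∧ ∀ a b (σ : Store), σ b = u a →
    ∃ t σ', Exec (P b) σ t σ' ∧ σ' b = v a ∧ (∀ i < b, σ' i = σ i) ∧ t ≤ T a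

/-- Truth values as trees. -/
noncomputable def truth (p : Prop) : Tree :=
  open Classical in if p then .cons .nil .nil else .nil

theorem truth_ne_nil {p : Prop} : truth p ≠ .nil ↔ p := by
  unfold truth; split_ifs with h <;> simp [h]

theorem truth_of {p : Prop} (h : p) : truth p = .cons .nil .nil := if_pos h

theorem truth_of_not {p : Prop} (h : ¬ p) : truth p = .nil := if_neg h

/-- The encoding of a list of encoded objects. -/
def encL {α : Type} (enc : α → Tree) (l : List α) : Tree := Tree.ofList (l.map enc)

namespace Computes

variable {Γ : Type} {μ : Γ → ℕ} {u v w x y : Γ → Tree}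

theorem comap (h : Computes μ u v) {Δ : Type} (f : Δ → Γ) :
    Computes (fun x => μ (f x)) (fun x => u (f x)) (fun x => v (f x)) := by
  obtain ⟨P, T, hT, h⟩ := h
  exact ⟨P, fun x => T (f x), hT.comap f, fun a => h (f a)⟩

theorem of_eq (h : Computes μ u v) (hv : ∀ a, v a = w a) : Computes μ u w :=
  (funext hv : v = w) ▸ h

theorem of_iff {p q : Γ → Prop} (h : Computes μ u fun a => truth (p a))
    (hpq : ∀ a, p a ↔ q a) : Computes μ u fun a => truth (q a) :=
  h.of_eq fun a => by rw [propext (hpq a)]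

theorem comp (h : Computes μ u v) (h' : Computes μ v w) : Computes μ u w := by
  obtain ⟨P, T, hT, h⟩ := h
  obtain ⟨P', T', hT', h'⟩ := h'
  refine ⟨fun b => .seq (P b) (P' b), _, hT.add hT', fun a b σ hσ => ?_⟩
  obtain ⟨t, σ₁, h1, h2, h3, h4⟩ := h a b σ hσ
  obtain ⟨t', σ₂, h1', h2', h3', h4'⟩ := h' a b σ₁ h2
  exact ⟨_, σ₂, .seq h1 h1', h2', fun i hi => (h3' i hi).trans (h3 i hi), add_le_add h4 h4'⟩

theorem id : Computes μ u u :=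
  ⟨fun _ => .skip, fun _ => 1, .const 1, fun _ _ σ hσ => ⟨1, σ, .skip σ, hσ, fun _ _ => rfl, le_rfl⟩⟩

theorem of_expr (E : ℕ → Expr) (c : ℕ) (hc : ∀ b, (E b).cost ≤ c)
    (h : ∀ a b (σ : Store), σ b = u a → (E b).eval σ = v a) : Computes μ u v := by
  refine ⟨fun b => .assign b (E b), fun _ => c + 1, .const _, fun a b σ hσ =>
    ⟨_, _, .assign σ b (E b), by simp [h a b σ hσ], fun i hi => ?_, by simpa using hc b⟩⟩
  exact Function.update_of_ne hi.ne _ _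

theorem nil : Computes μ u fun _ => Tree.nil :=
  of_expr (fun _ => .nil) 1 (fun _ => le_rfl) fun _ _ _ _ => rfl

theorem hd (h : Computes μ u v) : Computes μ u fun a => (v a).hd :=
  h.comp <| of_expr (fun b => .hd (.var b)) 2 (fun _ => le_rfl) fun a b σ hσ => by
    simp [Expr.eval, hσ]

theorem tl (h : Computes μ u v) : Computes μ u fun a => (v a).tl :=
  h.comp <| of_expr (fun b => .tl (.var b)) 2 (fun _ => le_rfl) fun a b σ hσ => by
    simp [Expr.eval, hσ]

/-- A program overwrites its own register but none below it. So the input stays in `b`, copies of it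
are processed in `b + 1` and `b + 2`, and the first result survives the second computation. -/
theorem cons (hv : Computes μ u v) (hw : Computes μ u w) :
    Computes μ u fun a => Tree.cons (v a) (w a) := by
  obtain ⟨P, T, hT, h⟩ := hv
  obtain ⟨P', T', hT', h'⟩ := hw
  refine ⟨fun b => .seq (.assign (b + 1) (.var b)) (.seq (P (b + 1))
    (.seq (.assign (b + 2) (.var b)) (.seq (P' (b + 2))
      (.assign b (.cons (.var (b + 1)) (.var (b + 2))))))),
    fun a => T a + T' a + 20, (hT.add hT').add (.const 20), fun a b σ hσ => ?_⟩
  obtain ⟨t1, σ1, e1, r1, f1, b1⟩ := h a (b + 1) (Function.update σ (b + 1) (σ b)) (by simp [hσ])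
  obtain ⟨t2, σ2, e2, r2, f2, b2⟩ := h' a (b + 2) (Function.update σ1 (b + 2) (σ1 b)) (by
    rw [Function.update_self, f1 b (by omega), Function.update_of_ne (by omega), hσ])
  refine ⟨_, _, .seq (.assign _ _ _) (.seq e1 (.seq (.assign _ _ _) (.seq e2 (.assign _ _ _)))),
    ?_, fun i hi => ?_, ?_⟩
  · rw [Function.update_self]
    simp only [Expr.eval]
    rw [r2, f2 (b + 1) (by omega), Function.update_of_ne (by omega), r1]
  · rw [Function.update_of_ne (by omega), f2 i (by omega), Function.update_of_ne (by omega),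
      f1 i (by omega), Function.update_of_ne (by omega)]
  · simp only [Expr.cost]
    omega

theorem ite {p : Γ → Prop} [∀ a, Decidable (p a)] (hp : Computes μ u fun a => truth (p a))
    (hv : Computes μ u v) (hw : Computes μ u w) :
    Computes μ u fun a => if p a then v a else w a := by
  obtain ⟨P, T, hT, h⟩ := hp
  obtain ⟨P1, T1, hT1, h1⟩ := hv
  obtain ⟨P2, T2, hT2, h2⟩ := hw
  refine ⟨fun b => .seq (.assign (b + 1) (.var b)) (.seq (P (b + 1))
    (.ite (.var (b + 1)) (P1 b) (P2 b))), fun a => T a + (T1 a + T2 a) + 20,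
    (hT.add (hT1.add hT2)).add (.const 20), fun a b σ hσ => ?_⟩
  obtain ⟨t, σ1, e1, r1, f1, b1⟩ := h a (b + 1) (Function.update σ (b + 1) (σ b)) (by simp [hσ])
  have hb : σ1 b = u a := by
    rw [f1 b (by omega), Function.update_of_ne (by omega), hσ]
  have hf : ∀ i < b, σ1 i = σ i := fun i hi => by
    rw [f1 i (by omega), Function.update_of_ne (by omega)]
  by_cases hpa : p a
  · obtain ⟨t2, σ2, e2, r2, f2, b2⟩ := h1 a b σ1 hb
    refine ⟨_, σ2, .seq (.assign _ _ _) (.seq e1 (.iteTrue ?_ e2)), ?_,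
      fun i hi => (f2 i hi).trans (hf i hi), ?_⟩
    · simpa [Expr.eval, r1, truth_ne_nil] using hpa
    · simp [hpa, r2]
    · simp only [Expr.cost]; omega
  · obtain ⟨t2, σ2, e2, r2, f2, b2⟩ := h2 a b σ1 hb
    refine ⟨_, σ2, .seq (.assign _ _ _) (.seq e1 (.iteFalse ?_ e2)), ?_,
      fun i hi => (f2 i hi).trans (hf i hi), ?_⟩
    · simp [Expr.eval, r1, truth_of_not hpa]
    · simp [hpa, r2]
    · simp only [Expr.cost]; omega

/-! ### Truth values -/

theorem ne_nil (h : Computes μ u v) : Computes μ u fun a => truth (v a ≠ Tree.nil) := by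
  obtain ⟨P, T, hT, h⟩ := h
  refine ⟨fun b => .seq (P b) (.ite (.var b) (.assign b (.cons .nil .nil)) .skip),
    fun a => T a + 20, hT.add (.const 20), fun a b σ hσ => ?_⟩
  obtain ⟨t, σ1, e1, r1, f1, b1⟩ := h a b σ hσ
  by_cases hv : v a = Tree.nil
  · refine ⟨_, σ1, .seq e1 (.iteFalse (by simp [Expr.eval, r1, hv]) (.skip _)), ?_, f1, ?_⟩
    · exact (r1.trans hv).trans (truth_of_not (not_not.2 hv)).symm
    · simp only [Expr.cost]; omega
  · refine ⟨_, _, .seq e1 (.iteTrue (by simp [Expr.eval, r1, hv]) (.assign _ _ _)), ?_,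
      fun i hi => ?_, ?_⟩
    · exact (Function.update_self ..).trans (truth_of hv).symm
    · rw [Function.update_of_ne hi.ne, f1 i hi]
    · simp only [Expr.cost]; omega

theorem true : Computes μ u fun _ => truth True :=
  (cons (nil (μ := μ) (u := u)) nil).of_eq fun _ => (truth_of trivial).symm

theorem false : Computes μ u fun _ => truth False :=
  nil.of_eq fun _ => (truth_of_not not_false).symm

section

variable {p q : Γ → Prop}

theorem not (hp : Computes μ u fun a => truth (p a)) : Computes μ u fun a => truth (¬ p a) := by
  classical
  refine (ite hp false true).of_eq fun a => ?_
  by_cases h : p a <;> simp [h]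

theorem and (hp : Computes μ u fun a => truth (p a)) (hq : Computes μ u fun a => truth (q a)) :
    Computes μ u fun a => truth (p a ∧ q a) := by
  classical
  refine (ite hp hq false).of_eq fun a => ?_
  by_cases h : p a <;> simp [h]

theorem or (hp : Computes μ u fun a => truth (p a)) (hq : Computes μ u fun a => truth (q a)) :
    Computes μ u fun a => truth (p a ∨ q a) := by
  classical
  refine (ite hp true hq).of_eq fun a => ?_
  by_cases h : p a <;> simp [h]

theorem imp (hp : Computes μ u fun a => truth (p a)) (hq : Computes μ u fun a => truth (q a)) :
    Computes μ u fun a => truth (p a → q a) :=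
  (hp.not.or hq).of_iff fun _ => imp_iff_not_or.symm

end

/-! ### Loops -/

/-- A loop over the list `l a`.  The body transforms the accumulator `g a i` into `g a (i + 1)`; it
sees the environment and the rest of the list. -/
theorem fold {l : Γ → List Tree} {g : Γ → ℕ → Tree}
    (hl : Computes μ u fun a => Tree.ofList (l a)) (hb : PolyBound μ fun a => (l a).length)
    (h0 : Computes μ u fun a => g a 0)
    (hs : Computes (fun x : {x : Γ × ℕ // x.2 < (l x.1).length} => μ x.1.1)
      (fun x => Tree.cons (Tree.cons (u x.1.1) (g x.1.1 x.1.2))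
        (Tree.ofList ((l x.1.1).drop x.1.2)))
      (fun x => g x.1.1 (x.1.2 + 1))) :
    Computes μ u fun a => g a (l a).length := by
  obtain ⟨PL, TL, hTL, hL⟩ := hl
  obtain ⟨P0, T0, hT0, h0⟩ := h0
  obtain ⟨B, TB, ⟨e, hTB⟩, hB⟩ := hs
  -- Register `b` keeps the environment, `b + 1` the rest of the list, `b + 2` the accumulator, and
  -- `b + 3` is the workspace of the body.
  refine ⟨fun b => .seq (.assign (b + 1) (.var b)) (.seq (PL (b + 1))
    (.seq (.assign (b + 2) (.var b)) (.seq (P0 (b + 2))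
    (.seq (.loop (.var (b + 1)) (.seq (.assign (b + 3) (.cons (.cons (.var b) (.var (b + 2)))
        (.var (b + 1)))) (.seq (B (b + 3)) (.seq (.assign (b + 2) (.var (b + 3)))
        (.assign (b + 1) (.tl (.var (b + 1))))))))
      (.assign b (.var (b + 2))))))),
    fun a => TL a + T0 a + (l a).length * ((μ a + 2) ^ e + 30) + 20,
    ((hTL.add hT0).add (hb.mul (.add ⟨e, fun _ => le_rfl⟩ (.const 30)))).add (.const 20),
    fun a b σ hσ => ?_⟩
  -- Here `r` counts the remaining rounds. The `30` covers the test and the assignments of one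
  -- round, the final `2` the last test.
  have loop : ∀ r i, i + r = (l a).length → ∀ σ : Store, σ b = u a → σ (b + 2) = g a i →
      σ (b + 1) = Tree.ofList ((l a).drop i) → ∃ t σ',
      Exec (.loop (.var (b + 1)) (.seq (.assign (b + 3) (.cons (.cons (.var b) (.var (b + 2)))
        (.var (b + 1)))) (.seq (B (b + 3)) (.seq (.assign (b + 2) (.var (b + 3)))
        (.assign (b + 1) (.tl (.var (b + 1)))))))) σ t σ' ∧ σ' (b + 2) = g a (l a).length ∧
      (∀ i < b, σ' i = σ i) ∧ t ≤ r * ((μ a + 2) ^ e + 30) + 2 := by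
    intro r
    induction r with
    | zero =>
      intro i hi σ _ h2 h3
      refine ⟨_, σ, .loopDone ?_, ?_, fun _ _ => rfl, ?_⟩
      · have hi' : (l a).length ≤ i := by omega
        simp [Expr.eval, h3, List.drop_eq_nil_of_le hi', Tree.ofList]
      · rw [h2, ← hi]; rfl
      · simp [Expr.cost]
    | succ r ih =>
      intro i hi σ h1 h2 h3
      have hlt : i < (l a).length := by omega
      obtain ⟨t1, σ1, e1, r1, f1, b1⟩ := hB ⟨(a, i), hlt⟩ (b + 3) (Function.update σ (b + 3)
        ((Expr.cons (.cons (.var b) (.var (b + 2))) (.var (b + 1))).eval σ)) (by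
          simp [Expr.eval, h1, h2, h3])
      have f1' : ∀ j, j < b + 3 → σ1 j = σ j := fun j hj => by
        rw [f1 j hj, Function.update_of_ne (by omega)]
      obtain ⟨t2, σ2, e2, r2, f2, b2⟩ := ih (i + 1) (by omega)
        (Function.update (Function.update σ1 (b + 2) (σ1 (b + 3))) (b + 1)
          ((Function.update σ1 (b + 2) (σ1 (b + 3)) (b + 1)).tl))
        (by rw [Function.update_of_ne (by omega), Function.update_of_ne (by omega),
          f1' b (by omega), h1])
        (by rw [Function.update_of_ne (by omega), Function.update_self, r1])
        (by
          rw [Function.update_self, Function.update_of_ne (by omega), f1' (b + 1) (by omega), h3,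
            List.drop_eq_getElem_cons hlt]
          rfl)
      have hcond : (Expr.var (b + 1)).eval σ ≠ Tree.nil := by
        rw [Expr.eval, h3, List.drop_eq_getElem_cons hlt]
        simp [Tree.ofList]
      refine ⟨_, σ2, .loopStep hcond (.seq (.assign _ _ _) (.seq e1 (.seq (.assign _ _ _)
        (.assign _ _ _)))) e2, r2, fun j hj => ?_, ?_⟩
      · rw [f2 j hj, Function.update_of_ne (by omega), Function.update_of_ne (by omega),
          f1' j (by omega)]
      · have := hTB ⟨(a, i), hlt⟩
        simp only [Expr.cost] at *
        rw [Nat.succ_mul]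
        omega
  obtain ⟨t1, σ1, e1, r1, f1, b1⟩ := hL a (b + 1) (Function.update σ (b + 1) (σ b)) (by simp [hσ])
  obtain ⟨t2, σ2, e2, r2, f2, b2⟩ := h0 a (b + 2) (Function.update σ1 (b + 2) (σ1 b)) (by
    rw [Function.update_self, f1 b (by omega), Function.update_of_ne (by omega), hσ])
  obtain ⟨t3, σ3, e3, r3, f3, b3⟩ := loop (l a).length 0 (by omega) σ2
    (by rw [f2 b (by omega), Function.update_of_ne (by omega), f1 b (by omega),
      Function.update_of_ne (by omega), hσ]) r2
    (by rw [f2 (b + 1) (by omega), Function.update_of_ne (by omega), r1]; simp)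
  refine ⟨_, _, .seq (.assign _ _ _) (.seq e1 (.seq (.assign _ _ _) (.seq e2 (.seq e3
    (.assign _ _ _))))), ?_, fun i hi => ?_, ?_⟩
  · rw [Function.update_self]
    exact r3
  · rw [Function.update_of_ne (by omega), f3 i (by omega), f2 i (by omega),
      Function.update_of_ne (by omega), f1 i (by omega), Function.update_of_ne (by omega)]
  · simp only [Expr.cost]
    omega

/-- The loop `fold` for a fold over a list of encoded objects. -/
theorem foldl {β δ : Γ → Type} {enc : ∀ a, β a → Tree} {encδ : ∀ a, δ a → Tree}
    {l : ∀ a, List (β a)} {f : ∀ a, δ a → β a → δ a} {init : ∀ a, δ a}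
    (hl : Computes μ u fun a => encL (enc a) (l a)) (hb : PolyBound μ fun a => (l a).length)
    (h0 : Computes μ u fun a => encδ a (init a))
    (hs : Computes (fun x : {x : Γ × ℕ // x.2 < (l x.1).length} => μ x.1.1)
      (fun x => Tree.cons (Tree.cons (u x.1.1)
        (encδ x.1.1 (((l x.1.1).take x.1.2).foldl (f x.1.1) (init x.1.1))))
        (enc x.1.1 ((l x.1.1)[x.1.2]'x.2)))
      (fun x => encδ x.1.1 (f x.1.1 (((l x.1.1).take x.1.2).foldl (f x.1.1) (init x.1.1))
        ((l x.1.1)[x.1.2]'x.2)))) :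
    Computes μ u fun a => encδ a ((l a).foldl (f a) (init a)) := by
  refine (fold (l := fun a => (l a).map (enc a))
    (g := fun a i => encδ a (((l a).take i).foldl (f a) (init a))) hl (by simpa using hb) h0
      ?_).of_eq fun a => by simp
  have hs' := hs.comap (fun x : {x : Γ × ℕ // x.2 < ((l x.1).map (enc x.1)).length} =>
    (⟨x.1, by simpa using x.2⟩ : {x : Γ × ℕ // x.2 < (l x.1).length}))
  have e1 := (id (μ := fun x : {x : Γ × ℕ // x.2 < ((l x.1).map (enc x.1)).length} => μ x.1.1)
    (u := fun x => Tree.cons (Tree.cons (u x.1.1)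
        (encδ x.1.1 (((l x.1.1).take x.1.2).foldl (f x.1.1) (init x.1.1))))
        (Tree.ofList (((l x.1.1).map (enc x.1.1)).drop x.1.2))))
  refine ((e1.hd.cons e1.tl.hd).of_eq fun x => ?_).comp (hs'.of_eq fun x => ?_)
  · have hx : x.1.2 < (l x.1.1).length := by simpa using x.2
    simp [Tree.hd, Tree.tl, List.drop_eq_getElem_cons x.2, Tree.ofList]
  · have hx : x.1.2 < (l x.1.1).length := by simpa using x.2
    simp only [← List.foldl_concat, List.take_concat_get' _ _ hx]

end Computes

/-! ### Programs that search lists and compare numbers -/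

/-- The elements of the lists `l a`. -/
abbrev Elem {Γ : Type} {β : Γ → Type} (l : ∀ a, List (β a)) : Type :=
  {x : Σ a, β a // x.2 ∈ l x.1}

/-- The nonempty suffixes of the lists `l a`. -/
abbrev Suff {Γ : Type} {β : Γ → Type} (l : ∀ a, List (β a)) : Type :=
  {x : Σ a, List (β a) // x.2 <:+ l x.1 ∧ x.2 ≠ []}

theorem encL_eq_nil {α : Type} {enc : α → Tree} {l : List α} :
    encL enc l = Tree.nil ↔ l = [] := by
  cases l <;> simp [encL, Tree.ofList]

theorem ofList_drop_ne_nil {l : List Tree} {i : ℕ} :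
    Tree.ofList (l.drop i) ≠ Tree.nil ↔ i < l.length := by
  rw [← not_le, ← List.drop_eq_nil_iff]
  cases l.drop i <;> simp [Tree.ofList]

theorem ofNat_eq_ofList (k : ℕ) : Tree.ofNat k = Tree.ofList (List.replicate k Tree.nil) := by
  induction k with
  | zero => rfl
  | succ k ih => rw [List.replicate_succ, Tree.ofList, ← ih, Tree.ofNat]

namespace Computes

variable {Γ : Type} {μ : Γ → ℕ} {u v w x y : Γ → Tree}

theorem env : Computes μ (fun a => Tree.cons (v a) (w a)) v := id.hd

theorem last : Computes μ (fun a => Tree.cons (v a) (w a)) w := id.tl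

/-- Inside a loop the environment `w` has grown; whatever was computable from `u` remains so once
`u` can be extracted from `w`. -/
theorem lift (h : Computes μ u v) {Δ : Type} (f : Δ → Γ) {w : Δ → Tree}
    (hw : Computes (fun x => μ (f x)) w (fun x => u (f x))) :
    Computes (fun x => μ (f x)) w (fun x => v (f x)) :=
  hw.comp (h.comap f)

/-- The test and the map need to be computed on elements of `l a` only; indexing by `Elem l` lets
their bounds use facts about these elements. -/
theorem push {β δ : Γ → Type} {enc : ∀ a, β a → Tree} {encδ : ∀ a, δ a → Tree}
    {l : ∀ a, List (β a)} {p : ∀ a, β a → Prop} [∀ a, DecidablePred (p a)]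
    {f : ∀ a, β a → δ a} {acc : ∀ a, List (δ a)}
    (hl : Computes μ u fun a => encL (enc a) (l a)) (hb : PolyBound μ fun a => (l a).length)
    (h0 : Computes μ u fun a => encL (encδ a) (acc a))
    (hp : Computes (fun x : Elem l => μ x.1.1) (fun x => Tree.cons (u x.1.1) (enc x.1.1 x.1.2))
      fun x => truth (p x.1.1 x.1.2))
    (hf : Computes (fun x : Elem l => μ x.1.1) (fun x => Tree.cons (u x.1.1) (enc x.1.1 x.1.2))
      fun x => encδ x.1.1 (f x.1.1 x.1.2)) :
    Computes μ u fun a => encL (encδ a)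
      ((l a).foldl (fun acc x => if p a x then f a x :: acc else acc) (acc a)) := by
  refine foldl (δ := fun a => List (δ a)) (encδ := fun a => encL (encδ a)) hl hb h0 ?_
  let φ : {x : Γ × ℕ // x.2 < (l x.1).length} → Elem l := fun x =>
    ⟨⟨x.1.1, (l x.1.1)[x.1.2]'x.2⟩, List.getElem_mem _⟩
  have e : Computes (fun x => μ (φ x).1.1) (fun x : {x : Γ × ℕ // x.2 < (l x.1).length} =>
      Tree.cons (Tree.cons (u x.1.1) (encL (encδ x.1.1) (((l x.1.1).take x.1.2).foldl
        (fun acc y => if p x.1.1 y then f x.1.1 y :: acc else acc) (acc x.1.1))))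
        (enc x.1.1 ((l x.1.1)[x.1.2]'x.2)))
      (fun x => Tree.cons (u (φ x).1.1) (enc (φ x).1.1 (φ x).1.2)) := id.hd.hd.cons id.tl
  refine (ite (hp.lift φ e) ((hf.lift φ e).cons env.tl) env.tl).of_eq fun x => ?_
  dsimp only [φ]
  split_ifs <;> rfl

theorem select {β : Γ → Type} {enc : ∀ a, β a → Tree} {l : ∀ a, List (β a)}
    {p : ∀ a, β a → Prop}
    (hl : Computes μ u fun a => encL (enc a) (l a)) (hb : PolyBound μ fun a => (l a).length)
    (hp : Computes (fun x : Elem l => μ x.1.1) (fun x => Tree.cons (u x.1.1) (enc x.1.1 x.1.2))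
      fun x => truth (p x.1.1 x.1.2)) :
    Computes μ u fun a => encL (enc a) (BGP.select (p a) (l a)) := by
  classical
  refine (push hl hb (encδ := enc) (acc := fun _ => []) (f := fun _ x => x) nil hp last).of_eq
    fun a => ?_
  rw [BGP.select]

theorem exists_mem {β : Γ → Type} {enc : ∀ a, β a → Tree} {l : ∀ a, List (β a)}
    {p : ∀ a, β a → Prop}
    (hl : Computes μ u fun a => encL (enc a) (l a)) (hb : PolyBound μ fun a => (l a).length)
    (hp : Computes (fun x : Elem l => μ x.1.1) (fun x => Tree.cons (u x.1.1) (enc x.1.1 x.1.2))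
      fun x => truth (p x.1.1 x.1.2)) :
    Computes μ u fun a => truth (∃ x ∈ l a, p a x) := by
  refine (select hl hb hp).ne_nil.of_iff fun a => ?_
  rw [Ne, encL_eq_nil, List.eq_nil_iff_forall_not_mem]
  simp

/-- The rest of the list, which `fold` shows to its body, runs through exactly the nonempty
suffixes. -/
theorem exists_suffix {β : Γ → Type} {enc : ∀ a, β a → Tree} {l : ∀ a, List (β a)}
    {p : ∀ a, List (β a) → Prop}
    (hl : Computes μ u fun a => encL (enc a) (l a)) (hb : PolyBound μ fun a => (l a).length)
    (hp : Computes (fun x : Suff l => μ x.1.1)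
      (fun x => Tree.cons (u x.1.1) (encL (enc x.1.1) x.1.2)) fun x => truth (p x.1.1 x.1.2)) :
    Computes μ u fun a => truth (∃ T, T <:+ l a ∧ T ≠ [] ∧ p a T) := by
  refine (fold (l := fun a => (l a).map (enc a))
    (g := fun a i => truth (∃ j < i, p a ((l a).drop j))) hl (by simpa using hb)
    (false.of_iff fun a => by simp) ?_).of_iff fun a => ?_
  · let φ : {x : Γ × ℕ // x.2 < ((l x.1).map (enc x.1)).length} → Suff l := fun x =>
      ⟨⟨x.1.1, (l x.1.1).drop x.1.2⟩, List.drop_suffix _ _, by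
        have := x.2
        simp only [List.length_map] at this
        simpa using this⟩
    have hp' := hp.lift φ ((env.hd.cons last).of_eq (u := fun x => Tree.cons (Tree.cons (u x.1.1)
      (truth (∃ j < x.1.2, p x.1.1 ((l x.1.1).drop j))))
      (Tree.ofList (((l x.1.1).map (enc x.1.1)).drop x.1.2))) fun x => by
        simp [φ, encL, List.map_drop, Tree.hd])
    refine (env.tl.or hp').of_iff fun x => ?_
    simp only [φ, Nat.lt_succ_iff_lt_or_eq, or_and_right, exists_or, exists_eq_left]
  · constructor
    · rintro ⟨j, hj, h⟩
      exact ⟨_, List.drop_suffix _ _, by simpa using hj, h⟩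
    · rintro ⟨T, ⟨S, hS⟩, h0, h⟩
      refine ⟨S.length, ?_, ?_⟩
      · rw [List.length_map, ← hS, List.length_append]
        have := List.length_pos_of_ne_nil h0
        omega
      · rwa [← hS, List.drop_left]

/-! ### Numbers and lists -/

/-- One cell of `l'` is removed for each cell of `l`. As numbers are unary, this yields the
comparison of lengths and of numbers as well as access by index. -/
theorem drop {l l' : Γ → List Tree} (hl : Computes μ u fun a => Tree.ofList (l a))
    (hb : PolyBound μ fun a => (l a).length) (hl' : Computes μ u fun a => Tree.ofList (l' a)) :
    Computes μ u fun a => Tree.ofList ((l' a).drop (l a).length) := by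
  refine fold (g := fun a i => Tree.ofList ((l' a).drop i)) hl hb hl' (env.tl.tl.of_eq fun x => ?_)
  rw [← List.tail_drop]
  cases List.drop x.1.2 (l' x.1.1) <;> rfl

theorem length_lt {β β' : Γ → Type} {enc : ∀ a, β a → Tree} {enc' : ∀ a, β' a → Tree}
    {l : ∀ a, List (β a)} {l' : ∀ a, List (β' a)}
    (hl : Computes μ u fun a => encL (enc a) (l a)) (hb : PolyBound μ fun a => (l a).length)
    (hl' : Computes μ u fun a => encL (enc' a) (l' a)) :
    Computes μ u fun a => truth ((l a).length < (l' a).length) :=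
  (drop (l := fun a => (l a).map (enc a)) (l' := fun a => (l' a).map (enc' a)) hl
    (by simpa using hb) hl').ne_nil.of_iff fun a => by
      rw [ofList_drop_ne_nil, List.length_map, List.length_map]

section

variable {i j : Γ → ℕ}

theorem nat_lt (hi : Computes μ u fun a => Tree.ofNat (i a)) (hb : PolyBound μ i)
    (hj : Computes μ u fun a => Tree.ofNat (j a)) : Computes μ u fun a => truth (i a < j a) := by
  simp only [ofNat_eq_ofList] at hi hj
  exact (drop hi (by simpa using hb) hj).ne_nil.of_iff fun a => by
    rw [ofList_drop_ne_nil, List.length_replicate, List.length_replicate]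

theorem nat_eq (hi : Computes μ u fun a => Tree.ofNat (i a)) (hbi : PolyBound μ i)
    (hj : Computes μ u fun a => Tree.ofNat (j a)) (hbj : PolyBound μ j) :
    Computes μ u fun a => truth (i a = j a) :=
  ((nat_lt hi hbi hj).not.and (nat_lt hj hbj hi).not).of_iff fun a => by omega

theorem getElem {β : Γ → Type} {enc : ∀ a, β a → Tree} {l : ∀ a, List (β a)}
    (hl : Computes μ u fun a => encL (enc a) (l a)) (hi : Computes μ u fun a => Tree.ofNat (i a))
    (hb : PolyBound μ i) (h : ∀ a, i a < (l a).length) :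
    Computes μ u fun a => enc a ((l a)[i a]'(h a)) := by
  simp only [ofNat_eq_ofList] at hi
  refine (drop hi (by simpa using hb) hl).hd.of_eq fun a => ?_
  rw [List.length_replicate, List.drop_eq_getElem_cons (by simpa using h a)]
  simp [Tree.ofList, Tree.hd]

end

section

variable {β : Γ → Type} {enc : ∀ a, β a → Tree} {l : ∀ a, List (β a)}

theorem tail (hl : Computes μ u fun a => encL (enc a) (l a)) :
    Computes μ u fun a => encL (enc a) (l a).tail :=
  hl.tl.of_eq fun a => by cases l a <;> rfl

theorem eq_nil (hl : Computes μ u fun a => encL (enc a) (l a)) :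
    Computes μ u fun a => truth (l a = []) :=
  hl.ne_nil.not.of_iff fun a => by rw [not_not, encL_eq_nil]

theorem headD (hl : Computes μ u fun a => encL (enc a) (l a)) {z : ∀ a, β a}
    (hz : Computes μ u fun a => enc a (z a)) :
    Computes μ u fun a => enc a ((l a).headD (z a)) := by
  classical
  refine (ite hl.eq_nil hz hl.hd).of_eq fun a => ?_
  cases l a <;> simp [encL, Tree.ofList, Tree.hd]

end

end Computes

/-! ### Programs for vertices -/

/-- Vertices as trees. -/
def vt {n : ℕ} (v : Fin n) : Tree := Tree.ofNat v

namespace Computes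

variable {Γ : Type} {μ : Γ → ℕ} {u : Γ → Tree} {N : Γ → ℕ} {x y : ∀ a, Fin (N a)}

theorem fin_lt (hN : PolyBound μ N) (hx : Computes μ u fun a => vt (x a))
    (hy : Computes μ u fun a => vt (y a)) : Computes μ u fun a => truth (x a < y a) :=
  nat_lt hx (hN.mono fun a => (x a).2.le) hy

theorem fin_eq (hN : PolyBound μ N) (hx : Computes μ u fun a => vt (x a))
    (hy : Computes μ u fun a => vt (y a)) : Computes μ u fun a => truth (x a = y a) :=
  (nat_eq hx (hN.mono fun a => (x a).2.le) hy (hN.mono fun a => (y a).2.le)).of_iff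
    fun _ => Fin.ext_iff.symm

/-- The numbers `n - 1, …, 0` for a list of length `n`. -/
theorem countdown {l : Γ → List Tree} (hl : Computes μ u fun a => Tree.ofList (l a))
    (hb : PolyBound μ fun a => (l a).length) (hN : ∀ a, (l a).length = N a) :
    Computes μ u fun a => encL vt (List.finRange (N a)).reverse := by
  -- The accumulator starts as the list of the single number `0` and has its largest number in
  -- front, whose successor takes one new cell. The loop makes one number too many, which `h.tl`
  -- drops.
  have h : Computes μ u fun a => encL Tree.ofNat (List.range ((l a).length + 1)).reverse :=
    fold (g := fun a i => encL Tree.ofNat (List.range (i + 1)).reverse) hl hb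
      ((nil.cons nil).of_eq fun a => rfl)
      (((nil.cons env.tl.hd).cons env.tl).of_eq fun x => by
        rw [List.range_succ (n := x.1.2 + 1), List.range_succ (n := x.1.2)]
        simp [encL, Tree.ofList, Tree.ofNat, Tree.hd, Tree.tl])
  refine h.tl.of_eq fun a => ?_
  rw [List.range_succ, hN]
  simp [encL, Tree.ofList, Tree.tl, ← List.map_coe_finRange_eq_range, Function.comp_def]
  rfl

end Computes

end WhileProg

/-! ### Programs for links, classes and comparisons of paths -/

namespace BGP
open WhileProg

/-- Paths as trees. -/
abbrev pt {n : ℕ} (P : List (Fin n)) : Tree := encL vt P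

/-- The rows of the matrix of relationships as a tree. -/
def HijackInput.rows (I : HijackInput) : Tree :=
  encL (fun u => encL (fun v => (I.G.link u v).toTree) (List.finRange I.n)) (List.finRange I.n)

/-- The environment `u` gives access to the input. -/
structure HasInput {Γ : Type} (μ : Γ → ℕ) (u : Γ → Tree) (I : Γ → HijackInput) : Prop where
  bound : PolyBound μ fun a => (I a).n
  rows : Computes μ u fun a => (I a).rows
  verts : Computes μ u fun a => encL vt (I a).verts
  s : Computes μ u fun a => vt (I a).s
  d : Computes μ u fun a => vt (I a).d
  m : Computes μ u fun a => vt (I a).m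

namespace HasInput

variable {Γ : Type} {μ : Γ → ℕ} {u : Γ → Tree} {I : Γ → HijackInput}

theorem lift (h : HasInput μ u I) {Δ : Type} (f : Δ → Γ) {w : Δ → Tree}
    (hw : Computes (fun x => μ (f x)) w (fun x => u (f x))) :
    HasInput (fun x => μ (f x)) w (fun x => I (f x)) :=
  ⟨h.bound.comap f, h.rows.lift f hw, h.verts.lift f hw, h.s.lift f hw, h.d.lift f hw,
    h.m.lift f hw⟩

variable {x y : ∀ a, Fin (I a).n} {P Q : ∀ a, List (Fin (I a).n)}

theorem link (h : HasInput μ u I) (hx : Computes μ u fun a => vt (x a))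
    (hy : Computes μ u fun a => vt (y a)) :
    Computes μ u fun a => ((I a).G.link (x a) (y a)).toTree := by
  have h1 := (h.rows : Computes μ u fun a => encL _ _).getElem (i := fun a => (x a : ℕ)) hx
    (h.bound.mono fun a => (x a).2.le) (fun a => by simp)
  have h2 := h1.getElem (i := fun a => (y a : ℕ)) hy
    (h.bound.mono fun a => (y a).2.le) (fun a => by simp)
  exact h2.of_eq fun a => by simp

variable {L : Γ → Link}

theorem eq_none (h : Computes μ u fun a => (L a).toTree) :
    Computes μ u fun a => truth (L a = Link.none) :=
  h.ne_nil.not.of_iff fun a => by cases L a <;> simp [Link.toTree, Tree.ofNat]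

theorem eq_provider (h : Computes μ u fun a => (L a).toTree) :
    Computes μ u fun a => truth (L a = Link.provider) :=
  h.tl.tl.ne_nil.of_iff fun a => by cases L a <;> simp [Link.toTree, Tree.ofNat, Tree.tl]

theorem cls (h : Computes μ u fun a => (L a).toTree) :
    Computes μ u fun a => Tree.ofNat (L a).cls := by
  classical
  -- The codes `1`, `2`, `3` of customer, peer, provider run opposite to the classes `3`, `2`, `1`;
  -- the tests ask for a code of at least `3`, `2`, `1`.
  refine (Computes.ite h.tl.tl.ne_nil (.cons .nil .nil) (Computes.ite h.tl.ne_nil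
    (.cons .nil (.cons .nil .nil)) (Computes.ite h.ne_nil
    (.cons .nil (.cons .nil (.cons .nil .nil))) .nil))).of_eq fun a => ?_
  cases L a <;> simp [Link.toTree, Tree.ofNat, Tree.tl, Link.cls]

theorem hop (h : HasInput μ u I) (hP : Computes μ u fun a => pt (P a)) :
    Computes μ u fun a => vt (Network.hop (I a).d (P a)) :=
  hP.tail.headD h.d

theorem pcls (h : HasInput μ u I) (hP : Computes μ u fun a => pt (P a)) :
    Computes μ u fun a => Tree.ofNat ((I a).G.pcls (P a)) := by
  classical
  refine (Computes.ite hP.tail.eq_nil .nil (cls (h.link (hP.headD h.d) (h.hop hP)))).of_eq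
    fun a => ?_
  rcases P a with _ | ⟨v, _ | ⟨w, T⟩⟩ <;> simp [Network.pcls, Network.hop, Tree.ofNat]

theorem boundPcls : PolyBound μ fun a => (I a).G.pcls (P a) :=
  (PolyBound.const 3).mono fun _ => Network.pcls_le _

theorem localPref (h : HasInput μ u I) (hP : Computes μ u fun a => pt (P a))
    (hPl : PolyBound μ fun a => (P a).length) (hQ : Computes μ u fun a => pt (Q a))
    (hQl : PolyBound μ fun a => (Q a).length) :
    Computes μ u fun a => truth ((I a).G.LocalPref (I a).d (Q a) (P a)) := by
  have hl := hQ.length_lt hQl hP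
  refine ((Computes.nat_lt (h.pcls hP) boundPcls (h.pcls hQ)).or
    ((Computes.nat_eq (h.pcls hP) boundPcls (h.pcls hQ) boundPcls).and
      (hl.or ((hl.not.and (hP.length_lt hPl hQ).not).and
        (Computes.fin_lt h.bound (h.hop hQ) (h.hop hP)))))).of_iff fun a => ?_
  rw [Network.LocalPref]
  refine or_congr_right (and_congr_right fun _ => or_congr_right (and_congr_left fun _ => ?_))
  omega

/-- Membership in a list of vertices. -/
theorem mem (h : HasInput μ u I) (hx : Computes μ u fun a => vt (x a))
    (hP : Computes μ u fun a => pt (P a)) (hPl : PolyBound μ fun a => (P a).length) :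
    Computes μ u fun a => truth (x a ∈ P a) :=
  (hP.exists_mem hPl (p := fun a y => y = x a)
    (Computes.fin_eq (h.bound.comap _) .last (hx.lift (fun x : Elem P => x.1.1) .env))).of_iff
    fun a => by simp

theorem beats (h : HasInput μ u I) (hP : Computes μ u fun a => pt (P a))
    (hPl : PolyBound μ fun a => (P a).length) (hQ : Computes μ u fun a => pt (Q a))
    (hQl : PolyBound μ fun a => (Q a).length) :
    Computes μ u fun a => truth ((I a).G.Beats (I a).d (P a) (Q a)) := by
  refine hP.exists_suffix hPl (p := fun a T => (Q a).headD (I a).d = T.headD (I a).d ∧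
    (I a).G.LocalPref (I a).d (Q a) T) ?_
  let φ : Suff P → Γ := fun x => x.1.1
  have h' := h.lift φ (w := fun x => Tree.cons (u x.1.1) (pt x.1.2)) .env
  have hQ' := hQ.lift φ (w := fun x => Tree.cons (u x.1.1) (pt x.1.2)) .env
  exact (Computes.fin_eq h'.bound (hQ'.headD h'.d) (Computes.last.headD h'.d)).and
    (h'.localPref .last ((hPl.comap φ).mono fun x => x.2.1.length_le) hQ' (hQl.comap φ))

/-- `[x, m]` is a suffix of `P`. -/
theorem via (h : HasInput μ u I) (hx : Computes μ u fun a => vt (x a))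
    (hP : Computes μ u fun a => pt (P a)) (hPl : PolyBound μ fun a => (P a).length) :
    Computes μ u fun a => truth ([x a, (I a).m] <:+ P a) := by
  refine (hP.exists_suffix hPl (p := fun a T => T.tail ≠ [] ∧ T.tail.tail = [] ∧
    T.headD (I a).d = x a ∧ Network.hop (I a).d T = (I a).m) ?_).of_iff fun a => ?_
  · let φ : Suff P → Γ := fun x => x.1.1
    have h' := h.lift φ (w := fun x => Tree.cons (u x.1.1) (pt x.1.2)) .env
    exact Computes.last.tail.eq_nil.not.and (Computes.last.tail.tail.eq_nil.and
      ((Computes.fin_eq h'.bound (Computes.last.headD h'.d) (hx.lift φ .env)).and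
        (Computes.fin_eq h'.bound (h'.hop .last) h'.m)))
  · constructor
    · rintro ⟨T, hT, h0, h1, h2, h3, h4⟩
      rcases T with _ | ⟨v, _ | ⟨w, _ | ⟨z, T⟩⟩⟩ <;> simp_all [Network.hop]
    · intro hs
      exact ⟨_, hs, by simp, by simp, rfl, rfl, rfl⟩

/-- `[m]` is a suffix of `P`. -/
theorem ends (h : HasInput μ u I) (hP : Computes μ u fun a => pt (P a))
    (hPl : PolyBound μ fun a => (P a).length) :
    Computes μ u fun a => truth ([(I a).m] <:+ P a) := by
  refine (hP.exists_suffix hPl (p := fun a T => T.tail = [] ∧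
    T.headD (I a).d = (I a).m) ?_).of_iff fun a => ?_
  · have h' := h.lift (fun x : Suff P => x.1.1) (w := fun x => Tree.cons (u x.1.1) (pt x.1.2)) .env
    exact Computes.last.tail.eq_nil.and
      (Computes.fin_eq h'.bound (Computes.last.headD h'.d) h'.m)
  · constructor
    · rintro ⟨T, hT, h0, h1, h2⟩
      rcases T with _ | ⟨v, _ | ⟨w, T⟩⟩ <;> simp_all
    · intro hs
      exact ⟨_, hs, by simp, rfl, rfl⟩

end HasInput

/-! ### The list of all routes -/

namespace HijackInput

open Network

/-- The route `P` can be extended by the vertex `v`. -/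
def Ext (I : HijackInput) (v : Fin I.n) (P : List (Fin I.n)) : Prop :=
  v ∉ P ∧ v ≠ I.d ∧ v ≠ I.m ∧ I.G.link v (P.headD I.d) ≠ Link.none ∧
    (I.G.link v (P.headD I.d) ≠ Link.provider → P.tail = [] ∨ I.G.pcls P = 3)

open Classical in
/-- The trivial routes and the extensions of the routes in `L` by one vertex. -/
noncomputable def extend (I : HijackInput) (L : List (List (Fin I.n))) : List (List (Fin I.n)) :=
  I.verts.foldl (fun acc v => L.foldl (fun acc P => if I.Ext v P then (v :: P) :: acc else acc)
    acc) [[I.d], [I.m]]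

/-- The routes with at most `i` vertices. -/
noncomputable def routes (I : HijackInput) (i : ℕ) : List (List (Fin I.n)) := I.extend^[i] []

theorem foldl_push {α β : Type*} (p : α → Prop) [DecidablePred p] (f : α → β) (l : List α)
    (acc : List β) : l.foldl (fun acc x => if p x then f x :: acc else acc) acc =
      ((l.filter p).map f).reverse ++ acc := by
  induction l generalizing acc with
  | nil => simp
  | cons a l ih => by_cases h : p a <;> simp [ih, h]

theorem mem_extend {I : HijackInput} {L : List (List (Fin I.n))} {P : List (Fin I.n)} :
    P ∈ I.extend L ↔ (P = [I.d] ∨ P = [I.m]) ∨ ∃ v, ∃ Q ∈ L, I.Ext v Q ∧ P = v :: Q := by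
  classical
  have key : ∀ (V : List (Fin I.n)) (acc : List (List (Fin I.n))),
      P ∈ V.foldl (fun acc v => L.foldl
        (fun acc P => if I.Ext v P then (v :: P) :: acc else acc) acc) acc ↔
      P ∈ acc ∨ ∃ v ∈ V, ∃ Q ∈ L, I.Ext v Q ∧ P = v :: Q := by
    intro V
    induction V with
    | nil => simp
    | cons w V ih =>
      intro acc
      rw [List.foldl_cons, ih, foldl_push]
      simp only [List.mem_append, List.mem_reverse, List.mem_map, List.mem_filter,
        decide_eq_true_eq, List.mem_cons, exists_eq_or_imp]
      have : (∃ a, (a ∈ L ∧ I.Ext w a) ∧ w :: a = P) ↔ ∃ Q ∈ L, I.Ext w Q ∧ P = w :: Q :=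
        exists_congr fun Q => by rw [and_assoc, eq_comm]
      rw [this, or_assoc, or_left_comm]
  rw [extend]
  refine (key _ _).trans ?_
  simp [I.mem_verts]

theorem ext_iff {I : HijackInput} {v : Fin I.n} {P : List (Fin I.n)}
    (hP : I.G.Route I.d I.m Set.univ P) : I.Ext v P ↔ I.G.Route I.d I.m Set.univ (v :: P) := by
  obtain ⟨w, T, rfl⟩ := List.exists_cons_of_ne_nil hP.ne_nil
  constructor
  · rintro ⟨h1, h2, h3, h4, h5⟩
    exact .cons hP h1 h2 h3 (valleyFree_cons_cons.2 ⟨h4, h5, hP.valleyFree⟩) fun _ => trivial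
  · intro h
    cases h with
    | cons _ h1 h2 h3 h4 _ =>
      have h5 := valleyFree_cons_cons.1 h4
      exact ⟨h1, h2, h3, h5.1, h5.2.1⟩

theorem mem_routes {I : HijackInput} {i : ℕ} {P : List (Fin I.n)} :
    P ∈ I.routes i ↔ I.G.Route I.d I.m Set.univ P ∧ P.length ≤ i := by
  induction i generalizing P with
  | zero =>
    simp only [routes, Function.iterate_zero, id_eq, List.not_mem_nil, Nat.le_zero,
      List.length_eq_zero_iff, false_iff, not_and]
    exact fun h => h.ne_nil
  | succ i ih =>
    rw [routes, Function.iterate_succ_apply', ← routes, mem_extend]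
    constructor
    · rintro ((rfl | rfl) | ⟨v, Q, hQ, he, rfl⟩)
      · exact ⟨.dest, by simp⟩
      · exact ⟨.fake, by simp⟩
      · rw [ih] at hQ
        exact ⟨(ext_iff hQ.1).1 he, by simpa using hQ.2⟩
    · rintro ⟨h, hl⟩
      have h' := h
      cases h with
      | dest => simp
      | fake => simp
      | @cons v Q hQ _ _ _ _ _ =>
        exact Or.inr ⟨v, Q, ih.2 ⟨hQ, by simpa using hl⟩, (ext_iff hQ).2 h', rfl⟩

theorem mem_routes_n {I : HijackInput} {P : List (Fin I.n)} :
    P ∈ I.routes I.n ↔ I.G.Route I.d I.m Set.univ P :=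
  mem_routes.trans (and_iff_left_of_imp fun h => by simpa using h.nodup.length_le_card)

/-- This lets powers of `n` absorb additive constants, both in the count of routes and in the final
time bound. -/
theorem three_le (I : HijackInput) : 3 ≤ I.n := by
  have h : ({I.s, I.d, I.m} : Finset (Fin I.n)).card = 3 := by
    rw [Finset.card_eq_three]
    exact ⟨_, _, _, I.s_ne_d, I.s_ne_m, I.d_ne_m, rfl⟩
  simpa [h] using Finset.card_le_univ ({I.s, I.d, I.m} : Finset (Fin I.n))

/-- Counting list entries by their length includes possible repetitions: an entry with at most `j +
1` vertices is one of the two initial ones or comes from a vertex and an entry with at most `j`. -/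
theorem countP_extend (I : HijackInput) (L : List (List (Fin I.n))) (j : ℕ) :
    (I.extend L).countP (·.length ≤ j + 1) ≤ 2 + I.n * L.countP (·.length ≤ j) := by
  classical
  have key : ∀ (V : List (Fin I.n)) (acc : List (List (Fin I.n))),
      (V.foldl (fun acc v => L.foldl
        (fun acc P => if I.Ext v P then (v :: P) :: acc else acc) acc) acc).countP
          (·.length ≤ j + 1) ≤
      acc.countP (·.length ≤ j + 1) + V.length * L.countP (·.length ≤ j) := by
    intro V
    induction V with
    | nil => simp
    | cons w V ih =>
      intro acc
      rw [List.foldl_cons]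
      refine (ih _).trans ?_
      rw [foldl_push, List.countP_append, List.countP_reverse, List.countP_map, List.length_cons,
        Nat.succ_mul]
      have : List.countP ((fun x : List (Fin I.n) => decide (x.length ≤ j + 1)) ∘ List.cons w)
          (List.filter (fun x => decide (I.Ext w x)) L) ≤ L.countP (·.length ≤ j) := by
        refine (List.Sublist.countP_le List.filter_sublist).trans (le_of_eq ?_)
        exact List.countP_congr fun x _ => by simp
      omega
  refine (key _ _).trans ?_
  rw [I.length_verts]
  exact Nat.add_le_add_right ((List.countP_le_length).trans (by simp)) _

/-- The strict inequality carries the induction: `2 + n * (n ^ j - 1) < n ^ (j + 1)` because `n ≥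
3`. -/
theorem countP_routes (I : HijackInput) (i j : ℕ) :
    (I.routes i).countP (·.length ≤ j) < I.n ^ j := by
  have h3 := I.three_le
  induction j generalizing i with
  | zero =>
    rw [pow_zero, Nat.lt_one_iff, List.countP_eq_zero]
    intro P hP
    have := List.length_pos_of_ne_nil (mem_routes.1 hP).1.ne_nil
    simp only [decide_eq_true_eq]
    omega
  | succ j ih =>
    cases i with
    | zero => simpa [routes] using Nat.pow_pos (by omega)
    | succ i =>
      rw [routes, Function.iterate_succ_apply', ← routes, pow_succ]
      have h1 := I.countP_extend (I.routes i) j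
      have h2 := Nat.mul_le_mul_left I.n (Nat.succ_le_of_lt (ih i))
      rw [mul_comm (I.n ^ j)]
      rw [Nat.mul_succ] at h2
      omega

/-- Routes are simple valley-free paths, so all entries have at most `k + 1` vertices. The bound
does not depend on `i`, hence also covers every intermediate list. -/
theorem length_routes_le (I : HijackInput) {k : ℕ} (hk : I.G.PathsBounded k) (i : ℕ) :
    (I.routes i).length ≤ I.n ^ (k + 1) := by
  refine le_trans (le_of_eq ?_) (I.countP_routes i (k + 1)).le
  refine (List.countP_eq_length.2 fun P hP => ?_).symm
  have h := (mem_routes.1 hP).1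
  simpa using hk P h.nodup h.valleyFree

end HijackInput
-- Programs for the list of routes, greediness and pruning
open WhileProg Network

namespace HasInput

variable {Γ : Type} {μ : Γ → ℕ} {u : Γ → Tree} {I : Γ → HijackInput}

theorem ext (h : HasInput μ u I) {v : ∀ a, Fin (I a).n} {P : ∀ a, List (Fin (I a).n)}
    (hv : Computes μ u fun a => vt (v a)) (hP : Computes μ u fun a => pt (P a))
    (hPl : PolyBound μ fun a => (P a).length) :
    Computes μ u fun a => truth ((I a).Ext (v a) (P a)) := by
  have hl := h.link hv (hP.headD h.d)
  exact (h.mem hv hP hPl).not.and ((Computes.fin_eq h.bound hv h.d).not.and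
    ((Computes.fin_eq h.bound hv h.m).not.and ((eq_none hl).not.and
      ((eq_provider hl).not.imp (hP.tail.eq_nil.or (Computes.nat_eq (h.pcls hP) boundPcls
        (Computes.cons .nil (.cons .nil (.cons .nil .nil))) (.const 3)))))))

theorem extend (h : HasInput μ u I) {L : ∀ a, List (List (Fin (I a).n))}
    (hL : Computes μ u fun a => encL pt (L a)) (hb : PolyBound μ fun a => (L a).length)
    (hl : ∀ a, ∀ P ∈ L a, P.length ≤ (I a).n) :
    Computes μ u fun a => encL pt ((I a).extend (L a)) := by
  classical
  refine Computes.foldl (δ := fun a => List (List (Fin (I a).n)))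
    (encδ := fun a L => encL pt L) h.verts
    (h.bound.mono fun a => (I a).length_verts.le)
    (.cons (.cons h.d .nil) (.cons (.cons h.m .nil) .nil)) ?_
  let φ : {x : Γ × ℕ // x.2 < ((I x.1).verts).length} → Γ := fun x => x.1.1
  let L' : ∀ x, List (List (Fin (I (φ x)).n)) := fun x => L (φ x)
  have h' := h.lift (fun y : Elem L' => φ y.1.1) (w := fun y => Tree.cons (Tree.cons (Tree.cons
    (u (φ y.1.1)) (encL pt (((I (φ y.1.1)).verts.take y.1.1.1.2).foldl (fun acc v =>
      (L (φ y.1.1)).foldl (fun acc P => if (I (φ y.1.1)).Ext v P then (v :: P) :: acc else acc)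
        acc) [[(I (φ y.1.1)).d], [(I (φ y.1.1)).m]])))
          (vt ((I (φ y.1.1)).verts[y.1.1.1.2]'y.1.1.2))) (pt y.1.2)) Computes.id.hd.hd.hd
  exact Computes.push (l := L') (p := fun x P => (I (φ x)).Ext
      ((I (φ x)).verts[x.1.2]'x.2) P) (f := fun x P => (I (φ x)).verts[x.1.2]'x.2 :: P)
    (hL.lift φ Computes.id.hd.hd) (hb.comap φ) Computes.id.hd.tl
    (h'.ext Computes.id.hd.tl .last ((h.bound.comap _).mono fun y => hl _ _ y.2))
    (.cons Computes.id.hd.tl .last)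

theorem routes (h : HasInput μ u I)
    (hb : PolyBound (fun x : Γ × ℕ => μ x.1) fun x => ((I x.1).routes x.2).length) :
    Computes μ u fun a => encL pt ((I a).routes (I a).n) := by
  -- The minimum bounds the lengths of the paths by `n` at every index; on the indices that the loop
  -- visits it changes nothing.
  refine (Computes.fold (l := fun a => (I a).verts.map vt)
    (g := fun a i => encL pt ((I a).routes (min i (I a).n))) h.verts
    (h.bound.mono fun a => by simp [(I a).length_verts]) .nil ?_).of_eq fun a => by
      simp [(I a).length_verts]
  let φ : {x : Γ × ℕ // x.2 < ((I x.1).verts.map vt).length} → Γ := fun x => x.1.1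
  have h' := h.lift φ (w := fun x => Tree.cons (Tree.cons (u x.1.1)
    (encL pt ((I x.1.1).routes (min x.1.2 (I x.1.1).n))))
      (Tree.ofList (((I x.1.1).verts.map vt).drop x.1.2))) Computes.id.hd.hd
  refine (h'.extend (L := fun x => (I x.1.1).routes (min x.1.2 (I x.1.1).n)) Computes.id.hd.tl
    (hb.comap fun x : {x : Γ × ℕ // x.2 < ((I x.1).verts.map vt).length} =>
      (x.1.1, min x.1.2 (I x.1.1).n)) fun x P hP =>
      (HijackInput.mem_routes.1 hP).2.trans (min_le_right _ _)).of_eq fun x => ?_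
  have hx : x.1.2 < (I x.1.1).n := by simpa [(I x.1.1).length_verts] using x.2
  rw [min_eq_left hx.le, min_eq_left hx, HijackInput.routes, HijackInput.routes,
    Function.iterate_succ_apply']

end HasInput

/-- The environment `u` gives access to the input and to the list of all routes. -/
structure HasRoutes {Γ : Type} (μ : Γ → ℕ) (u : Γ → Tree) (I : Γ → HijackInput) : Prop
    extends HasInput μ u I where
  routes : Computes μ u fun a => encL pt ((I a).routes (I a).n)
  boundRoutes : PolyBound μ fun a => ((I a).routes (I a).n).length

namespace HasRoutes

variable {Γ : Type} {μ : Γ → ℕ} {u : Γ → Tree} {I : Γ → HijackInput}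

theorem lift (h : HasRoutes μ u I) {Δ : Type} (f : Δ → Γ) {w : Δ → Tree}
    (hw : Computes (fun x => μ (f x)) w (fun x => u (f x))) :
    HasRoutes (fun x => μ (f x)) w (fun x => I (f x)) :=
  ⟨h.toHasInput.lift f hw, h.routes.lift f hw, h.boundRoutes.comap f⟩

theorem boundElem (h : HasRoutes μ u I) :
    PolyBound (fun x : Elem (fun a => (I a).routes (I a).n) => μ x.1.1) fun x => x.1.2.length :=
  (h.bound.comap fun x : Elem (fun a => (I a).routes (I a).n) => x.1.1).mono
    fun x => (HijackInput.mem_routes.1 x.2).2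

variable {A P Q : ∀ a, List (Fin (I a).n)}

theorem allowed (h : HasRoutes μ u I) (hA : Computes μ u fun a => pt (A a))
    (hAl : PolyBound μ fun a => (A a).length) (hP : Computes μ u fun a => pt (P a))
    (hPl : PolyBound μ fun a => (P a).length) :
    Computes μ u fun a => truth (∀ b, [b, (I a).m] <:+ P a → b ∈ A a) := by
  refine ((h.verts.exists_mem (h.bound.mono fun a => (I a).length_verts.le)
    (p := fun a b => [b, (I a).m] <:+ P a ∧ b ∉ A a) ?_).not).of_iff fun a => ?_
  · let φ : Elem (fun a => (I a).verts) → Γ := fun x => x.1.1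
    have h' := h.lift φ (w := fun x => Tree.cons (u x.1.1) (vt x.1.2)) .env
    exact (h'.via .last (hP.lift φ .env) (hPl.comap φ)).and
      (h'.mem .last (hA.lift φ .env) (hAl.comap φ)).not
  · simp [(I a).mem_verts]

/-- `Q` is a greedy route, provided that it is a route. -/
theorem greedy (h : HasRoutes μ u I) (hA : Computes μ u fun a => pt (A a))
    (hAl : PolyBound μ fun a => (A a).length) (hQ : Computes μ u fun a => pt (Q a))
    (hQl : PolyBound μ fun a => (Q a).length)
    (hr : ∀ a, (I a).G.Route (I a).d (I a).m Set.univ (Q a)) :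
    Computes μ u fun a => truth ((I a).G.Greedy (I a).d (I a).m {x | x ∈ A a} (Q a)) := by
  refine ((h.allowed hA hAl hQ hQl).and (hQ.exists_suffix hQl
    (p := fun a T => ∃ R ∈ (I a).routes (I a).n, (∀ b, [b, (I a).m] <:+ R → b ∈ A a) ∧
      R.headD (I a).d = T.headD (I a).d ∧ (I a).G.pcls T < (I a).G.pcls R) ?_).not).of_iff
        fun a => ?_
  · let φ : Suff Q → Γ := fun x => x.1.1
    let r : ∀ x : Suff Q, List (List (Fin (I (φ x)).n)) := fun x => (I (φ x)).routes (I (φ x)).n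
    have h1 := h.lift φ (w := fun x => Tree.cons (u x.1.1) (pt x.1.2)) .env
    refine h1.routes.exists_mem h1.boundRoutes (p := fun x R =>
      (∀ b, [b, (I (φ x)).m] <:+ R → b ∈ A (φ x)) ∧
      R.headD (I (φ x)).d = x.1.2.headD (I (φ x)).d ∧
        (I (φ x)).G.pcls x.1.2 < (I (φ x)).G.pcls R) ?_
    let ψ : Elem r → Suff Q := fun y => y.1.1
    have h2 := h1.lift ψ (w := fun y => Tree.cons (Tree.cons (u y.1.1.1.1) (pt y.1.1.1.2))
      (pt y.1.2)) .env
    have hT : Computes (fun y : Elem r => μ (φ (ψ y))) (fun y => Tree.cons (Tree.cons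
      (u y.1.1.1.1) (pt y.1.1.1.2)) (pt y.1.2)) fun y => pt (ψ y).1.2 := Computes.id.hd.tl
    exact (h2.allowed (hA.lift (fun y => φ (ψ y)) Computes.id.hd.hd) (hAl.comap _) .last
      h1.boundElem).and ((Computes.fin_eq h2.bound (Computes.last.headD h2.d)
        (hT.headD h2.d)).and (Computes.nat_lt (h2.pcls hT) HasInput.boundPcls (h2.pcls .last)))
  · rw [Greedy, route_iff, and_assoc]
    simp only [hr a, true_and, Set.mem_ofPred_eq]
    refine and_congr_right fun _ => ?_
    constructor
    · intro hn T hT h0 R hR hd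
      by_contra hlt
      have hR' := route_iff.1 hR
      exact hn ⟨T, hT, h0, R, HijackInput.mem_routes_n.2 hR'.1, hR'.2,
        (headD_eq_iff hR.ne_nil h0).2 hd, not_le.1 hlt⟩
    · rintro hg ⟨T, hT, h0, R, hR, hRA, hd, hlt⟩
      have hR' := HijackInput.mem_routes_n.1 hR
      exact absurd (hg T hT h0 R (route_iff.2 ⟨hR', hRA⟩)
        ((headD_eq_iff hR'.ne_nil h0).1 hd)) (not_le.2 hlt)

theorem exists_beats (h : HasRoutes μ u I) (hA : Computes μ u fun a => pt (A a))
    (hAl : PolyBound μ fun a => (A a).length) (hP : Computes μ u fun a => pt (P a))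
    (hPl : PolyBound μ fun a => (P a).length) :
    Computes μ u fun a => truth (∃ Q, (I a).G.Greedy (I a).d (I a).m {x | x ∈ A a} Q ∧
      (I a).G.Beats (I a).d (P a) Q) := by
  refine (h.routes.exists_mem h.boundRoutes (p := fun a Q =>
    (I a).G.Greedy (I a).d (I a).m {x | x ∈ A a} Q ∧ (I a).G.Beats (I a).d (P a) Q) ?_).of_iff
      fun a => ?_
  · let φ : Elem (fun a => (I a).routes (I a).n) → Γ := fun x => x.1.1
    have h' := h.lift φ (w := fun x => Tree.cons (u x.1.1) (pt x.1.2)) .env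
    exact (h'.greedy (hA.lift φ .env) (hAl.comap φ) .last h.boundElem
      fun x => HijackInput.mem_routes_n.1 x.2).and
        (h'.beats (hP.lift φ .env) (hPl.comap φ) .last h.boundElem)
  · exact ⟨fun ⟨Q, _, hQ⟩ => ⟨Q, hQ⟩, fun ⟨Q, hQ⟩ => ⟨Q,
      HijackInput.mem_routes_n.2 (hQ.1.1.mono (Set.subset_univ _)), hQ⟩⟩

theorem exists_beats_via (h : HasRoutes μ u I) (hA : Computes μ u fun a => pt (A a))
    (hAl : PolyBound μ fun a => (A a).length) (hP : Computes μ u fun a => pt (P a))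
    (hPl : PolyBound μ fun a => (P a).length) {b : ∀ a, Fin (I a).n}
    (hb : Computes μ u fun a => vt (b a)) :
    Computes μ u fun a => truth (∃ Q, (I a).G.Greedy (I a).d (I a).m {x | x ∈ A a} Q ∧
      (I a).G.Beats (I a).d (P a) Q ∧ [b a, (I a).m] <:+ Q) := by
  refine (h.routes.exists_mem h.boundRoutes (p := fun a Q =>
    (I a).G.Greedy (I a).d (I a).m {x | x ∈ A a} Q ∧ (I a).G.Beats (I a).d (P a) Q ∧
      [b a, (I a).m] <:+ Q) ?_).of_iff fun a => ?_
  · let φ : Elem (fun a => (I a).routes (I a).n) → Γ := fun x => x.1.1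
    have h' := h.lift φ (w := fun x => Tree.cons (u x.1.1) (pt x.1.2)) .env
    exact (h'.greedy (hA.lift φ .env) (hAl.comap φ) .last h.boundElem
      fun x => HijackInput.mem_routes_n.1 x.2).and
        ((h'.beats (hP.lift φ .env) (hPl.comap φ) .last h.boundElem).and
          (h'.via (hb.lift φ .env) .last h.boundElem))
  · exact ⟨fun ⟨Q, _, hQ⟩ => ⟨Q, hQ⟩, fun ⟨Q, hQ⟩ => ⟨Q,
      HijackInput.mem_routes_n.2 (hQ.1.1.mono (Set.subset_univ _)), hQ⟩⟩

theorem prune (h : HasRoutes μ u I) (hA : Computes μ u fun a => pt (A a))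
    (hAl : PolyBound μ fun a => (A a).length) (hP : Computes μ u fun a => pt (P a))
    (hPl : PolyBound μ fun a => (P a).length) :
    Computes μ u fun a => pt ((I a).G.prune (I a).d (I a).m (P a) (A a)) := by
  refine hA.select hAl ?_
  let φ : Elem A → Γ := fun x => x.1.1
  have h' := h.lift φ (w := fun x => Tree.cons (u x.1.1) (vt x.1.2)) .env
  exact (h'.exists_beats_via (hA.lift φ .env) (hAl.comap φ) (hP.lift φ .env) (hPl.comap φ)
    .last).not

theorem length_target (J : HijackInput) (p : List (Fin J.n)) (i : ℕ) :
    ((J.G.prune J.d J.m p)^[i] (BGP.select (fun v => J.G.link J.m v ≠ Link.none)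
      J.verts)).length ≤ J.n :=
  (length_iterate_prune _ _ _).trans ((length_select_le _ _).trans J.length_verts.le)

theorem target (h : HasRoutes μ u I) (hP : Computes μ u fun a => pt (P a))
    (hPl : PolyBound μ fun a => (P a).length) :
    Computes μ u fun a => pt ((I a).target (P a)) := by
  refine (Computes.fold (l := fun a => (I a).verts.map vt)
    (g := fun a i => pt (((I a).G.prune (I a).d (I a).m (P a))^[i]
      (BGP.select (fun v => (I a).G.link (I a).m v ≠ Link.none) (I a).verts))) h.verts
    (h.bound.mono fun a => by simp [(I a).length_verts]) ?_ ?_).of_eq fun a => by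
      simp [(I a).length_verts, HijackInput.target]
  · refine h.verts.select (h.bound.mono fun a => (I a).length_verts.le) ?_
    have h' := h.lift (fun x : Elem (fun a => (I a).verts) => x.1.1)
      (w := fun x => Tree.cons (u x.1.1) (vt x.1.2)) .env
    exact (HasInput.eq_none (h'.link h'.m .last)).not
  · let φ : {x : Γ × ℕ // x.2 < ((I x.1).verts.map vt).length} → Γ := fun x => x.1.1
    have h' := h.lift φ (w := fun x => Tree.cons (Tree.cons (u x.1.1)
      (pt (((I x.1.1).G.prune (I x.1.1).d (I x.1.1).m (P x.1.1))^[x.1.2]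
        (BGP.select (fun v => (I x.1.1).G.link (I x.1.1).m v ≠ Link.none) (I x.1.1).verts))))
      (Tree.ofList (((I x.1.1).verts.map vt).drop x.1.2))) Computes.id.hd.hd
    refine (h'.prune (A := fun x => ((I x.1.1).G.prune (I x.1.1).d (I x.1.1).m
      (P x.1.1))^[x.1.2] (BGP.select (fun v => (I x.1.1).G.link (I x.1.1).m v ≠ Link.none)
        (I x.1.1).verts)) Computes.id.hd.tl ((h.bound.comap φ).mono fun x => length_target _ _ _)
      (hP.lift φ Computes.id.hd.hd) (hPl.comap φ)).of_eq fun x => ?_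
    rw [Function.iterate_succ_apply']

theorem hijack (h : HasRoutes μ u I) : Computes μ u fun a => truth (I a).Hijack := by
  refine (h.routes.exists_mem h.boundRoutes (p := fun a p => p.headD (I a).d = (I a).s ∧
      [(I a).m] <:+ p ∧ (∀ b, [b, (I a).m] <:+ p → b ∈ (I a).target p) ∧
      ¬ ∃ Q, (I a).G.Greedy (I a).d (I a).m {x | x ∈ (I a).target p} Q ∧
        (I a).G.Beats (I a).d p Q) ?_).of_iff fun a => ?_
  · let φ : Elem (fun a => (I a).routes (I a).n) → Γ := fun x => x.1.1
    have h' := h.lift φ (w := fun x => Tree.cons (u x.1.1) (pt x.1.2)) .env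
    have hT := h'.target .last h.boundElem
    have hTl := h'.bound.mono fun x => length_target (I (φ x)) x.1.2 (I (φ x)).n
    exact (Computes.fin_eq h'.bound (Computes.last.headD h'.d) h'.s).and
      ((h'.ends .last h.boundElem).and ((h'.allowed hT hTl .last h.boundElem).and
        (h'.exists_beats hT hTl .last h.boundElem).not))
  · rw [HijackInput.hijack_iff_target]
    refine exists_congr fun p => ?_
    rw [HijackInput.mem_routes_n]
    refine and_congr_right fun hp => and_congr_right fun _ => and_congr_right fun _ =>
      and_congr_left fun _ => ?_
    rw [route_iff (A := {x | x ∈ (I a).target p})]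
    simp [hp]

end HasRoutes

/-! ### Running time -/

namespace HijackInput

/-- Networks with bounded valley-free paths, with the bound. -/
abbrev Bounded : Type := {x : ℕ × HijackInput // 1 ≤ x.1 ∧ x.2.G.PathsBounded x.1}

/-- The number `k` is part of the index and of the measure `n ^ k`, but not of the encoded input. As
`Computes` asks for one program for all indices, the program and the exponent are independent of
`k`. -/
theorem computes_hijack : Computes (fun x : Bounded => x.1.2.n ^ x.1.1)
    (fun x => x.1.2.toTree) fun x => truth x.1.2.Hijack := by
  have bound : PolyBound (fun x : Bounded => x.1.2.n ^ x.1.1) fun x => x.1.2.n :=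
    PolyBound.self.mono fun x => Nat.le_self_pow (by have := x.2.1; omega) _
  have rows : Computes (fun x : Bounded => x.1.2.n ^ x.1.1) (fun x => x.1.2.toTree)
    fun x => x.1.2.rows := Computes.id.hd
  have input : HasInput (fun x : Bounded => x.1.2.n ^ x.1.1) (fun x => x.1.2.toTree)
      fun x => x.1.2 :=
    ⟨bound, rows, Computes.countdown rows (bound.mono fun x => by simp) fun x => by simp,
      Computes.id.tl.hd, Computes.id.tl.tl.hd, Computes.id.tl.tl.tl.hd⟩
  have hb : PolyBound (fun x : Bounded × ℕ => x.1.1.2.n ^ x.1.1.1)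
      fun x => (x.1.1.2.routes x.2).length :=
    ((PolyBound.self.mul bound).comap (fun x : Bounded × ℕ => x.1)).mono fun x => by
      rw [← pow_succ]
      exact x.1.1.2.length_routes_le x.1.2.2 x.2
  have hu : Computes (fun x : Bounded => x.1.2.n ^ x.1.1) (fun x => x.1.2.toTree) fun x =>
      Tree.cons x.1.2.toTree (encL pt (x.1.2.routes x.1.2.n)) :=
    Computes.id.cons (input.routes hb)
  refine hu.comp (HasRoutes.hijack (I := fun x : Bounded => x.1.2) ⟨?_, .last, ?_⟩)
  · exact input.lift (fun x => x) .env
  · exact hb.comap (fun x : Bounded => (x, x.1.2.n))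

theorem n_le_size (I : HijackInput) : I.n ≤ I.toTree.size := by
  have h : ∀ l : List Tree, l.length ≤ (Tree.ofList l).size := by
    intro l
    induction l with
    | nil => simp
    | cons a l ih => simp only [List.length_cons, Tree.ofList, Tree.size]; omega
  refine le_trans ?_ (show I.rows.size ≤ I.toTree.size from ?_)
  · have h1 := h ((List.finRange I.n).map fun u =>
      encL (fun v => (I.G.link u v).toTree) (List.finRange I.n))
    rwa [List.length_map, List.length_finRange] at h1
  · show _ ≤ Tree.size (Tree.cons I.rows _)
    rw [Tree.size]
    omega

theorem exists_program : ∃ (p : Cmd) (c : ℕ), ∀ k : ℕ, 1 ≤ k → ∀ I : HijackInput,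
    I.G.PathsBounded k → DecidesWithin p I.toTree I.Hijack (I.n ^ (c * k)) := by
  obtain ⟨P, T, ⟨e, hT⟩, h⟩ := computes_hijack
  -- The factor `2` removes the shift in `(n ^ k + 2) ^ e`: as `n ^ k ≥ 3`, the base is at most `(n
  -- ^ k) ^ 2`.
  refine ⟨P 0, 2 * e, fun k hk I hI => ?_⟩
  obtain ⟨t, σ, h1, h2, -, h4⟩ := h ⟨(k, I), hk, hI⟩ 0 (start I.toTree) rfl
  refine ⟨t, σ, h1, (h4.trans (hT _)).trans ?_, by rw [h2]; exact truth_ne_nil⟩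
  have h3 : 3 ≤ I.n ^ k := I.three_le.trans (Nat.le_self_pow (by omega) _)
  calc (I.n ^ k + 2) ^ e ≤ ((I.n ^ k) ^ 2) ^ e := Nat.pow_le_pow_left (by nlinarith) e
    _ = I.n ^ (2 * e * k) := by rw [← pow_mul, ← pow_mul]; ring_nf

end HijackInput
end BGP

theorem mainTheorem3 :
    (∃ (p : WhileProg.Cmd) (c : ℕ), ∀ k : ℕ, 1 ≤ k → ∀ I : BGP.HijackInput,
      I.G.PathsBounded k → WhileProg.DecidesWithin p I.toTree I.Hijack (I.n ^ (c * k))) ∧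
    (∀ k : ℕ, WhileProg.InP (α := {I : BGP.HijackInput // I.G.PathsBounded k})
      (fun I => I.1.toTree) (fun I => I.1.Hijack)) := by
  refine ⟨BGP.HijackInput.exists_program, fun k => ?_⟩
  obtain ⟨p, c, h⟩ := BGP.HijackInput.exists_program
  -- The bound `k + 1` in place of `k` covers `k = 0`, which the first part excludes.
  refine ⟨p, Polynomial.X ^ (c * (k + 1)), fun I => ?_⟩
  obtain ⟨t, σ, h1, h2, h3⟩ := h (k + 1) (by omega) I.1
    fun P hP hvf => (I.2 P hP hvf).trans (by omega)
  refine ⟨t, σ, h1, h2.trans ?_, h3⟩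
  rw [Polynomial.eval_pow, Polynomial.eval_X]
  exact Nat.pow_le_pow_left I.1.n_le_size _
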